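/- Let $T$ be a finite tree whose edges $e$ are line segments of positive lengths, so that the points of $T$ are its vertices together with the interior points of its edges, and let $d(x,y)$ be the length of the simple path in $T$ between the points $x$ and $y$. Let $P_1,\dots,P_n$ be uncertain points on $T$: $P_i$ has a weight $w_i\ge 0$ and possible locations $p_{i1},\dots,p_{im_i}$ on $T$ with probabilities $f_{ij}\ge 0$, $\sum_{j=1}^{m_i} f_{ij}=1$. Put $M=\sum_{i=1}^n m_i$. Assume that all locations $p_{ij}$ are vertices of $T$ and that every vertex of $T$ holds at least one location (possibly several). For a point $x$ of $T$ let $$\mathsf{E}\mathrm{d}(x,P_i)=w_i\sum_{j=1}^{m_i} f_{ij}\, d(x,p_{ij}),$$ and call $x$ a median of $P_i$ if it minimizes $\mathsf{E}\mathrm{d}(\cdot,P_i)$ over all points of $T$. Then medians $p_1^*,\dots,p_n^*$ of all the uncertain points, each located at a vertex of $T$, can be computed together in $O(M\log M)$ time. Precisely: there are a single program for the unit-cost real random access machine (natural-number cells with addition, truncated subtraction, comparison and indirect addressing; real-number cells with $+,-,\times,\div$ and comparison; no conversion of reals to natural numbers) and a constant $C$ such that, on every such instance, given as the list of the edges of $T$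 with their lengths, the list of the $M$ locations (each with the index $i$ of its uncertain point, its vertex and its probability) and the list of the weights, the program halts after at most $C\,(M\log M+1)$ steps and has then written, for every $i\in\{1,\dots,n\}$, a vertex of $T$ that is a median of $P_i$. (The summand $1$ matters only for $M=1$.) -/

import Mathlib

/-! ### Trees with edge lengths, points of a tree, uncertain points -/

namespace UncertainTree

/-- A tree on the vertices `0, …, order - 1`, given by the list of its edges in any order (each edge
with its two end vertices in any order), every edge having a positive length. -/
structure LengthTree where
  order : ℕ
  size : ℕ
  src : Fin size → Fin order
  tgt : Fin size → Fin order
  len : Fin size → ℝ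
  src_ne_tgt : ∀ e, src e ≠ tgt e
  edge_injective : Function.Injective fun e => s(src e, tgt e)
  isTree : (SimpleGraph.fromEdgeSet (Set.range fun e => s(src e, tgt e))).IsTree
  len_pos : ∀ e, 0 < len e

namespace LengthTree

/-- The underlying graph. -/
def graph (T : LengthTree) : SimpleGraph (Fin T.order) :=
  SimpleGraph.fromEdgeSet (Set.range fun e => s(T.src e, T.tgt e))

/-- The simple path between two vertices (it exists and is unique in a tree). -/
noncomputable def path (T : LengthTree) (u v : Fin T.order) : T.graph.Walk u v :=
  (T.isTree.existsUnique_path u v).choose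

/-- The distance of two vertices: the sum of the lengths of the edges on the simple path. -/
noncomputable def vertexDist (T : LengthTree) (u v : Fin T.order) : ℝ :=
  ∑ e with s(T.src e, T.tgt e) ∈ (T.path u v).edges, T.len e

/-- The points of `T`: its vertices, and the points `onEdge e t` of the edge `e`, regarded as a
segment of length `len e`, at distance `t` from `src e`. (The end vertices of `e` are named
twice, which is harmless since both names have the same distances.) -/
inductive Point (T : LengthTree) where
  | vertex (v : Fin T.order) : Point T
  | onEdge (e : Fin T.size) (t : ℝ) (ht : t ∈ Set.Icc 0 (T.len e)) : Point T

/-- The distance `d(x, v)` of a point `x` and a vertex `v`. For a point `x` of the edge `e`, the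
simple path leaves `e` through one of its two ends, namely the one that makes it shorter. -/
noncomputable def dist (T : LengthTree) : T.Point → Fin T.order → ℝ
  | .vertex u, v => T.vertexDist u v
  | .onEdge e t _, v =>
      min (t + T.vertexDist (T.src e) v) ((T.len e - t) + T.vertexDist (T.tgt e) v)

end LengthTree

/-- A vertex-constrained instance: `n` uncertain points on the tree `T` with `M` locations
altogether, listed in any order. The `k`-th location is a location of the uncertain point
`owner k`, lies at the vertex `loc k`, and has probability `prob k`. Every vertex holds at least one
location (of some uncertain point); it may hold several. -/
structure Instance where
  T : LengthTree
  n : ℕ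
  M : ℕ
  owner : Fin M → Fin n
  loc : Fin M → Fin T.order
  prob : Fin M → ℝ
  weight : Fin n → ℝ
  loc_surjective : Function.Surjective loc
  prob_nonneg : ∀ k, 0 ≤ prob k
  prob_sum : ∀ i, ∑ k with owner k = i, prob k = 1
  weight_nonneg : ∀ i, 0 ≤ weight i

namespace Instance

/-- The weighted expected distance `Ed(x, P_i)`. -/
noncomputable def expDist (I : Instance) (x : I.T.Point) (i : Fin I.n) : ℝ :=
  I.weight i * ∑ k with I.owner k = i, I.prob k * I.T.dist x (I.loc k)

/-- `x` is a median of `P_i`: it minimizes `Ed(·, P_i)` over all points of the tree. -/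
def IsMedian (I : Instance) (i : Fin I.n) (x : I.T.Point) : Prop :=
  ∀ y : I.T.Point, I.expDist x i ≤ I.expDist y i

end Instance

end UncertainTree

/-! ### A real random access machine with unit costs -/

namespace RealRAM

/-- The memory: cell `i` of the natural-number array `a` is `nat a i`, and cell `i` of the
real-number array `a` is `real a i`. A program text names only finitely many arrays. -/
structure Memory where
  nat : ℕ → ℕ → ℕ
  real : ℕ → ℕ → ℝ

/-- Index arithmetic: constants, indirect addressing, sum and truncated difference. -/
inductive NatExpr where
  | const (c : ℕ)
  | get (a : ℕ) (i : NatExpr)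
  | add (x y : NatExpr)
  | sub (x y : NatExpr)

/-- Real arithmetic. There is no way to turn a real number into a natural one. -/
inductive RealExpr where
  | const (q : ℚ)
  | get (a : ℕ) (i : NatExpr)
  | add (x y : RealExpr)
  | sub (x y : RealExpr)
  | mul (x y : RealExpr)
  | div (x y : RealExpr)

/-- Tests. -/
inductive Test where
  | natLt (x y : NatExpr)
  | natEq (x y : NatExpr)
  | realLt (x y : RealExpr)
  | realEq (x y : RealExpr)
  | neg (b : Test)
  | conj (b c : Test)

/-- Programs. -/
inductive Program where
  | skip
  | setNat (a : ℕ) (i : NatExpr) (x : NatExpr)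
  | setReal (a : ℕ) (i : NatExpr) (x : RealExpr)
  | seq (p q : Program)
  | ite (b : Test) (p q : Program)
  | loop (b : Test) (p : Program)

namespace NatExpr

def eval (m : Memory) : NatExpr → ℕ
  | const c => c
  | get a i => m.nat a (i.eval m)
  | add x y => x.eval m + y.eval m
  | sub x y => x.eval m - y.eval m

/-- The number of operations and memory accesses. -/
def cost : NatExpr → ℕ
  | const _ => 1
  | get _ i => i.cost + 1
  | add x y => x.cost + y.cost + 1
  | sub x y => x.cost + y.cost + 1

end NatExpr

namespace RealExpr

noncomputable def eval (m : Memory) : RealExpr → ℝ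
  | const q => (q : ℝ)
  | get a i => m.real a (i.eval m)
  | add x y => x.eval m + y.eval m
  | sub x y => x.eval m - y.eval m
  | mul x y => x.eval m * y.eval m
  | div x y => x.eval m / y.eval m

/-- The number of operations and memory accesses. -/
def cost : RealExpr → ℕ
  | const _ => 1
  | get _ i => i.cost + 1
  | add x y => x.cost + y.cost + 1
  | sub x y => x.cost + y.cost + 1
  | mul x y => x.cost + y.cost + 1
  | div x y => x.cost + y.cost + 1

end RealExpr

namespace Test

def Holds (m : Memory) : Test → Prop
  | natLt x y => x.eval m < y.eval m
  | natEq x y => x.eval m = y.eval m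
  | realLt x y => x.eval m < y.eval m
  | realEq x y => x.eval m = y.eval m
  | neg b => ¬ b.Holds m
  | conj b c => b.Holds m ∧ c.Holds m

/-- The number of operations, comparisons and memory accesses. -/
def cost : Test → ℕ
  | natLt x y => x.cost + y.cost + 1
  | natEq x y => x.cost + y.cost + 1
  | realLt x y => x.cost + y.cost + 1
  | realEq x y => x.cost + y.cost + 1
  | neg b => b.cost + 1
  | conj b c => b.cost + c.cost + 1

end Test

namespace Memory

/-- Write `x` into cell `i` of the natural-number array `a`. -/
def writeNat (m : Memory) (a i x : ℕ) : Memory :=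
  { m with nat := Function.update m.nat a (Function.update (m.nat a) i x) }

/-- Write `x` into cell `i` of the real-number array `a`. -/
noncomputable def writeReal (m : Memory) (a i : ℕ) (x : ℝ) : Memory :=
  { m with real := Function.update m.real a (Function.update (m.real a) i x) }

end Memory

/-- `Runs p m t m'`: started on the memory `m`, the program `p` halts after exactly `t` steps with
the memory `m'`. -/
inductive Runs : Program → Memory → ℕ → Memory → Prop where
  | skip (m : Memory) : Runs .skip m 1 m
  | setNat (a : ℕ) (i x : NatExpr) (m : Memory) :
      Runs (.setNat a i x) m (i.cost + x.cost + 1) (m.writeNat a (i.eval m) (x.eval m))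
  | setReal (a : ℕ) (i : NatExpr) (x : RealExpr) (m : Memory) :
      Runs (.setReal a i x) m (i.cost + x.cost + 1) (m.writeReal a (i.eval m) (x.eval m))
  | seq {p q : Program} {m m' m'' : Memory} {s t : ℕ} :
      Runs p m s m' → Runs q m' t m'' → Runs (.seq p q) m (s + t) m''
  | ite_true {b : Test} {p : Program} (q : Program) {m m' : Memory} {t : ℕ} :
      b.Holds m → Runs p m t m' → Runs (.ite b p q) m (b.cost + t + 1) m'
  | ite_false {b : Test} (p : Program) {q : Program} {m m' : Memory} {t : ℕ} :
      ¬ b.Holds m → Runs q m t m' → Runs (.ite b p q) m (b.cost + t + 1) m'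
  | loop_done {b : Test} (p : Program) {m : Memory} :
      ¬ b.Holds m → Runs (.loop b p) m (b.cost + 1) m
  | loop_step {b : Test} {p : Program} {m m' m'' : Memory} {s t : ℕ} :
      b.Holds m → Runs p m s m' → Runs (.loop b p) m' t m'' →
        Runs (.loop b p) m (b.cost + s + t + 1) m''

end RealRAM

/-! ### Input and output of the median problem -/

namespace UncertainTree

/-- A finite sequence as the contents of an array, followed by zeros. -/
def toArray {α : Type} [Zero α] {k : ℕ} (f : Fin k → α) (i : ℕ) : α :=
  if h : i < k then f ⟨i, h⟩ else 0

/-- The memory that holds the instance `I` as input: in the natural-number arrays 0 to 4, the four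
sizes, the ends of the edges, and the owner and the vertex of each location; in the real-number arrays
0 to 2, the edge lengths, the probabilities and the weights. All other cells are zero. -/
noncomputable def Instance.input (I : Instance) : RealRAM.Memory where
  nat
    | 0 => toArray ![I.T.order, I.T.size, I.n, I.M]
    | 1 => toArray fun e => (I.T.src e : ℕ)
    | 2 => toArray fun e => (I.T.tgt e : ℕ)
    | 3 => toArray fun k => (I.owner k : ℕ)
    | 4 => toArray fun k => (I.loc k : ℕ)
    | _ => fun _ => 0
  real
    | 0 => toArray I.T.len
    | 1 => toArray I.prob
    | 2 => toArray I.weight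
    | _ => fun _ => 0

/-- The memory holds medians of all uncertain points, each at a vertex, in the natural-number
array 5: cell `i` is the number of a vertex that is a median of the `i`-th uncertain point. -/
def Instance.HoldsMedians (I : Instance) (m : RealRAM.Memory) : Prop :=
  ∀ i : Fin I.n, ∃ v : Fin I.T.order, m.nat 5 i = v ∧ I.IsMedian i (.vertex v)

end UncertainTree

/-! Medians depend only on masses. Removing an edge `e` splits the tree into two sides, and `e` lies
on the path between two vertices exactly when they are on different sides. Hence the unweighted
expected distance from a vertex `u` is the sum over all edges of the length times the probability of
the side not containing `u` (`Instance.sum_prob_mul_vertexDist`). A vertex that has mass at least `1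
/ 2` on its side of every edge minimizes every summand. Along an edge, distances to vertices are
affine (`LengthTree.dist_onEdge`), so interior points are no better than the ends
(`Instance.isMedian_of_heavy`). The program therefore needs neither lengths nor weights.

To find such a vertex, root the tree and number the vertices so that every subtree is an interval of
positions. For one uncertain point let `u` be the vertex at which the mass of the initial segments
of positions first exceeds `1 / 2`. An interval of mass above `1 / 2` must contain the position of
`u`, so every subtree of mass above `1 / 2` hangs at an ancestor of `u` (possibly `u` itself). The
lowest such ancestor is on the heavier side of every edge (`isMedian_of_half`).

Both `u` and the ancestor are thresholds of monotone tests, found by binary search. The searches for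
all uncertain points run simultaneously: one round computes the masses of one interval per point in
a single pass over the locations, in time `O(M)`, so no sorting is needed (`reach_search`). Jumping
to ancestors uses a doubling table with logarithmically many rows, one column per vertex.

The rooting and the numbering are computed in linear time by stripping leaves, without recursion or
adjacency lists: it suffices to keep for each vertex the number and the sum of its remaining
neighbours (`StripInv.step`). As there are at most `M` vertices and at most `M` uncertain points,
the total is `O(M log M)`. -/

namespace UncertainTree

/-! ### Rooted trees, and distance as a sum over separating edges. -/

namespace LengthTree

theorem path_isPath (T : LengthTree) (u v : Fin T.order) : (T.path u v).IsPath :=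
  (T.isTree.existsUnique_path u v).choose_spec.1

theorem eq_path (T : LengthTree) {u v : Fin T.order} (w : T.graph.Walk u v) (hw : w.IsPath) :
    w = T.path u v :=
  (T.isTree.existsUnique_path u v).choose_spec.2 w hw

theorem order_pos (T : LengthTree) : 0 < T.order := by
  obtain ⟨v⟩ := T.isTree.1.nonempty
  exact v.pos

/-- The tree rooted at the vertex `0`: parents, depths, and the lower end of every edge. -/
structure Rooting (T : LengthTree) where
  root : Fin T.order
  root_val : (root : ℕ) = 0
  par : Fin T.order → Fin T.order
  depth : Fin T.order → ℕ
  child : Fin T.size → Fin T.order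
  par_root : par root = root
  depth_root : depth root = 0
  depth_par : ∀ v, v ≠ root → depth v = depth (par v) + 1
  child_injective : Function.Injective child
  child_ne_root : ∀ e, child e ≠ root
  exists_child : ∀ v, v ≠ root → ∃ e, child e = v
  ends : ∀ e, (T.src e = child e ∧ T.tgt e = par (child e)) ∨
    (T.src e = par (child e) ∧ T.tgt e = child e)

theorem adj_iff (T : LengthTree) (u v : Fin T.order) :
    T.graph.Adj u v ↔ ∃ e, s(T.src e, T.tgt e) = s(u, v) := by
  unfold graph
  rw [SimpleGraph.fromEdgeSet_adj]
  refine ⟨fun h => h.1, fun h => ⟨h, ?_⟩⟩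
  obtain ⟨e, he⟩ := h
  rintro rfl
  have := T.src_ne_tgt e
  simp at he
  exact this (he.1.trans he.2.symm)

/-- The parent of `v` is the second vertex on the path to the root, and the depth is the length of
that path; the tail of the path is again the path from the parent. Of two adjacent vertices, either
the second lies on the path from the first to the root and is then its parent, or prepending it
gives its own path and the first is its parent. So each edge joins a vertex to its parent. -/
theorem nonempty_rooting (T : LengthTree) : Nonempty T.Rooting := by
  classical
  let r : Fin T.order := ⟨0, T.order_pos⟩
  let par : Fin T.order → Fin T.order := fun v => (T.path v r).snd
  let depth : Fin T.order → ℕ := fun v => (T.path v r).length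
  have hnil : T.path r r = .nil := (T.eq_path .nil SimpleGraph.Walk.IsPath.nil).symm
  have hcons : ∀ v, v ≠ r → T.graph.Adj v (par v) ∧ depth v = depth (par v) + 1 := by
    intro v hv
    have hn : ¬ (T.path v r).Nil := SimpleGraph.Walk.not_nil_of_ne hv
    refine ⟨SimpleGraph.Walk.adj_snd hn, ?_⟩
    have ht := T.eq_path (T.path v r).tail (T.path_isPath v r).tail
    change (T.path v r).length = (T.path (T.path v r).snd r).length + 1
    rw [← ht]
    exact (SimpleGraph.Walk.length_tail_add_one hn).symm
  have hadj : ∀ u v, T.graph.Adj u v → (u ≠ r ∧ par u = v) ∨ (v ≠ r ∧ par v = u) := by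
    intro u v h
    by_cases hs : v ∈ (T.path u r).support
    · left
      refine ⟨?_, (SimpleGraph.IsAcyclic.eq_snd_of_adj_start T.isTree.2 (T.path_isPath u r) h hs).symm⟩
      rintro rfl
      rw [hnil] at hs
      simp at hs
      exact h.ne hs.symm
    · right
      have hp := T.eq_path (.cons h.symm (T.path u r))
        ((SimpleGraph.Walk.cons_isPath_iff _ _).2 ⟨T.path_isPath u r, hs⟩)
      refine ⟨?_, ?_⟩
      · rintro rfl
        exact hs (SimpleGraph.Walk.end_mem_support _)
      · change (T.path v r).snd = u
        rw [← hp]; simp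
  have hdr : depth r = 0 := by change (T.path r r).length = 0; rw [hnil]; rfl
  have hpr : par r = r := by change (T.path r r).snd = r; rw [hnil]; rfl
  have hch : ∀ e, ∃ c, c ≠ r ∧ s(T.src e, T.tgt e) = s(c, par c) := by
    intro e
    rcases hadj _ _ ((T.adj_iff _ _).2 ⟨e, rfl⟩) with ⟨h1, h2⟩ | ⟨h1, h2⟩
    · exact ⟨_, h1, by rw [h2]⟩
    · exact ⟨_, h1, by rw [h2, Sym2.eq_swap]⟩
  choose ch hch1 hch2 using hch
  refine ⟨⟨r, rfl, par, depth, ch, hpr, hdr, fun v hv => (hcons v hv).2, ?_, hch1, ?_, ?_⟩⟩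
  · intro e e' h
    apply T.edge_injective
    simp only [hch2, h]
  · intro v hv
    obtain ⟨e, he⟩ := (T.adj_iff _ _).1 (hcons v hv).1
    refine ⟨e, ?_⟩
    rw [hch2, Sym2.eq_iff] at he
    rcases he with h | h
    · exact h.1
    -- Otherwise `v` and its parent would each be the parent of the other, which the depths forbid.
    · exfalso
      have h1 := (hcons v hv).2
      have h2 := (hcons _ (hch1 e)).2
      rw [h.2, h.1] at h2
      omega
  · intro e
    have := hch2 e
    rwa [Sym2.eq_iff] at this

namespace Rooting

variable {T : LengthTree} (R : T.Rooting)

/-- `R.Below c u`: the vertex `u` lies in the subtree hanging at `c`. -/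
def Below (c u : Fin T.order) : Prop := ∃ k, R.par^[k] u = c

theorem below_refl (c : Fin T.order) : R.Below c c := ⟨0, rfl⟩

theorem below_trans {a b c : Fin T.order} (h : R.Below a b) (h' : R.Below b c) : R.Below a c := by
  obtain ⟨k, hk⟩ := h
  obtain ⟨l, hl⟩ := h'
  exact ⟨k + l, by rw [Function.iterate_add_apply, hl, hk]⟩

theorem depth_iterate_par (u : Fin T.order) (k : ℕ) :
    R.depth (R.par^[k] u) = R.depth u - k := by
  induction k with
  | zero => rfl
  | succ k ih =>
    rw [Function.iterate_succ_apply']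
    by_cases h : R.par^[k] u = R.root
    · rw [h, R.depth_root] at ih
      rw [h, R.par_root, R.depth_root]
      omega
    · have := R.depth_par _ h
      omega

theorem eq_root_of_depth {u : Fin T.order} (h : R.depth u = 0) : u = R.root := by
  by_contra hu
  have := R.depth_par u hu
  omega

theorem iterate_par_eq_root {u : Fin T.order} {k : ℕ} (h : R.depth u ≤ k) :
    R.par^[k] u = R.root := by
  apply R.eq_root_of_depth
  rw [R.depth_iterate_par]
  omega

theorem below_root (u : Fin T.order) : R.Below R.root u :=
  ⟨R.depth u, R.iterate_par_eq_root le_rfl⟩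

theorem Below.depth_le {R : T.Rooting} {c u : Fin T.order} (h : R.Below c u) :
    R.depth c ≤ R.depth u := by
  obtain ⟨k, rfl⟩ := h
  rw [R.depth_iterate_par]
  omega

theorem below_antisymm {c u : Fin T.order} (h : R.Below c u) (h' : R.Below u c) : c = u := by
  obtain ⟨k, rfl⟩ := h
  have h1 := h'.depth_le
  rw [R.depth_iterate_par] at h1
  rcases Nat.eq_zero_or_pos k with rfl | hk
  · rfl
  · have h0 : R.depth u = 0 := by omega
    rw [R.eq_root_of_depth h0, R.iterate_par_eq_root (by rw [R.depth_root]; omega)]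

theorem below_iff_par {c u : Fin T.order} : R.Below c u ↔ u = c ∨ R.Below c (R.par u) := by
  constructor
  · rintro ⟨k, hk⟩
    cases k with
    | zero => exact .inl hk
    | succ k => exact .inr ⟨k, hk⟩
  · rintro (rfl | ⟨k, hk⟩)
    · exact R.below_refl _
    · exact ⟨k + 1, hk⟩

theorem not_below_par {c : Fin T.order} (hc : c ≠ R.root) : ¬ R.Below c (R.par c) := by
  intro h
  have h1 := h.depth_le
  have h2 := R.depth_par c hc
  omega

/-- The vertices on a descending path from the root have distinct depths. -/
theorem depth_lt_order (u : Fin T.order) : R.depth u < T.order := by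
  have hinj : Function.Injective fun k : Fin (R.depth u + 1) => R.par^[(k : ℕ)] u := by
    intro a b h
    have h' := congrArg R.depth h
    simp only [R.depth_iterate_par] at h'
    ext
    omega
  simpa using Fintype.card_le_of_injective _ hinj

/-- `R.child` is a bijection from the edges to the vertices other than the root, so anything
accumulated in a pass over the edge list can be read as a sum over vertices. -/
theorem sum_ne_root_eq_sum_edges {α : Type*} [AddCommMonoid α] (f : Fin T.order → α) :
    ∑ c with c ≠ R.root, f c = ∑ e, f (R.child e) := by
  classical
  rw [← Finset.sum_image (g := R.child) (f := f) (s := Finset.univ)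
    (fun _ _ _ _ h => R.child_injective h)]
  apply Finset.sum_congr _ fun _ _ => rfl
  ext c
  simp only [Finset.mem_filter, Finset.mem_univ, true_and, Finset.mem_image]
  exact ⟨fun h => R.exists_child c h, by rintro ⟨e, rfl⟩; exact R.child_ne_root e⟩

theorem _root_.UncertainTree.LengthTree.size_lt_order (T : LengthTree) : T.size < T.order := by
  classical
  obtain ⟨R⟩ := T.nonempty_rooting
  have h := R.sum_ne_root_eq_sum_edges (fun _ => 1)
  simp only [Finset.sum_const, smul_eq_mul, mul_one, Finset.card_univ, Fintype.card_fin] at h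
  rw [← h]
  simpa using Finset.card_lt_univ_of_notMem (s := Finset.univ.filter (fun c => c ≠ R.root))
    (x := R.root) (by simp)

theorem edge_eq (e : Fin T.size) : s(T.src e, T.tgt e) = s(R.child e, R.par (R.child e)) := by
  rcases R.ends e with ⟨h, h'⟩ | ⟨h, h'⟩
  · rw [h, h']
  · rw [h, h', Sym2.eq_swap]

/-- A parity argument: each step along `e` enters or leaves the subtree at `R.child e`, and no other
step does. -/
theorem below_iff_below_of_walk (e : Fin T.size) {u v : Fin T.order} (w : T.graph.Walk u v) :
    (R.Below (R.child e) u ↔ R.Below (R.child e) v) ↔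
      Even (w.edges.count s(T.src e, T.tgt e)) := by
  classical
  have step : ∀ c, c ≠ R.root → ((R.Below (R.child e) c ↔ R.Below (R.child e) (R.par c)) ↔
      c ≠ R.child e) := by
    intro c hc
    rw [R.below_iff_par (u := c)]
    by_cases h : c = R.child e
    · subst h
      simp [R.not_below_par hc]
    · simp [h]
  have step' : ∀ a b, T.graph.Adj a b → ((R.Below (R.child e) a ↔ R.Below (R.child e) b) ↔
      s(a, b) ≠ s(T.src e, T.tgt e)) := by
    intro a b hab
    obtain ⟨e', he'⟩ := (T.adj_iff _ _).1 hab
    rw [← he', T.edge_injective.ne_iff (x := e') (y := e), ← R.child_injective.ne_iff,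
      ← step _ (R.child_ne_root e')]
    rw [R.edge_eq e', Sym2.eq_iff] at he'
    rcases he' with ⟨h, h'⟩ | ⟨h, h'⟩
    · rw [h', h]
    · rw [h', h]; exact ⟨Iff.symm, Iff.symm⟩
  induction w with
  | nil => simp
  | @cons a b c hab w ih =>
    rw [SimpleGraph.Walk.edges_cons, List.count_cons]
    have hs := step' a b hab
    by_cases h : s(a, b) = s(T.src e, T.tgt e)
    · simp only [h, beq_self_eq_true, if_true]
      refine Iff.trans ?_ (Nat.even_add_one.trans (not_congr ih.symm)).symm
      simp only [h, ne_eq, not_true_eq_false, iff_false] at hs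
      tauto
    · simp only [beq_iff_eq, h, if_false, add_zero]
      refine Iff.trans ?_ ih
      simp only [h, ne_eq, not_false_eq_true, iff_true] at hs
      rw [hs]

open Classical in
-- A path uses each edge at most once, so an odd number of crossings means exactly one.
theorem vertexDist_eq (u v : Fin T.order) :
    T.vertexDist u v = ∑ e, if (R.Below (R.child e) u ↔ R.Below (R.child e) v) then 0
      else T.len e := by
  unfold vertexDist
  rw [Finset.sum_filter]
  refine Finset.sum_congr rfl fun e _ => ?_
  have hn := (T.path_isPath u v).isTrail.edges_nodup
  simp only [R.below_iff_below_of_walk e (T.path u v)]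
  by_cases h : s(T.src e, T.tgt e) ∈ (T.path u v).edges
  · have : (T.path u v).edges.count s(T.src e, T.tgt e) = 1 := List.count_eq_one_of_mem hn h
    simp [h, this]
  · simp [h, List.count_eq_zero_of_not_mem h]

end Rooting

end LengthTree

/-! ### Expected distances edge by edge, and a criterion for medians. -/

namespace Instance

variable (I : Instance)

/-- The probability that the `i`-th uncertain point lies in the set `S` of vertices. -/
noncomputable def mass (i : Fin I.n) (S : Fin I.T.order → Prop) [DecidablePred S] : ℝ :=
  ∑ k with I.owner k = i, if S (I.loc k) then I.prob k else 0

variable {I}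

theorem mass_mono {i : Fin I.n} {S S' : Fin I.T.order → Prop} [DecidablePred S]
    [DecidablePred S'] (h : ∀ v, S v → S' v) : I.mass i S ≤ I.mass i S' := by
  refine Finset.sum_le_sum fun k _ => ?_
  have := I.prob_nonneg k
  have := h (I.loc k)
  split_ifs <;> simp_all

theorem mass_add_mass_not (i : Fin I.n) (S : Fin I.T.order → Prop) [DecidablePred S] :
    I.mass i S + I.mass i (fun v => ¬ S v) = 1 := by
  rw [← I.prob_sum i, mass, mass, ← Finset.sum_add_distrib]
  refine Finset.sum_congr rfl fun k _ => ?_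
  split_ifs <;> simp_all

theorem mass_congr {i : Fin I.n} {S S' : Fin I.T.order → Prop} [DecidablePred S]
    [DecidablePred S'] (h : ∀ v, S v ↔ S' v) : I.mass i S = I.mass i S' :=
  le_antisymm (mass_mono fun v => (h v).1) (mass_mono fun v => (h v).2)

variable (R : I.T.Rooting)

open Classical in
-- Exchange the sums over locations and edges: each edge is paid for by exactly the locations on its
-- side away from `u`.
theorem sum_prob_mul_vertexDist (i : Fin I.n) (u : Fin I.T.order) :
    ∑ k with I.owner k = i, I.prob k * I.T.vertexDist u (I.loc k) =
      ∑ e, I.T.len e * (if R.Below (R.child e) u then 1 - I.mass i (R.Below (R.child e))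
        else I.mass i (R.Below (R.child e))) := by
  simp only [R.vertexDist_eq, Finset.mul_sum]
  rw [Finset.sum_comm]
  refine Finset.sum_congr rfl fun e _ => ?_
  have h1 : 1 - I.mass i (R.Below (R.child e)) = I.mass i (fun v => ¬ R.Below (R.child e) v) := by
    rw [← mass_add_mass_not i (R.Below (R.child e))]; ring
  rw [h1]
  by_cases h : R.Below (R.child e) u
  · simp only [h, if_true, mass, Finset.mul_sum]
    refine Finset.sum_congr rfl fun k _ => ?_
    by_cases h' : R.Below (R.child e) (I.loc k) <;> simp [h', mul_comm]
  · simp only [h, if_false, mass, Finset.mul_sum]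
    refine Finset.sum_congr rfl fun k _ => ?_
    by_cases h' : R.Below (R.child e) (I.loc k) <;> simp [h', mul_comm]

end Instance

namespace LengthTree

/-- The two ends of `e` lie on the same side of every edge except `e`. -/
theorem Rooting.vertexDist_child {T : LengthTree} (R : T.Rooting) (e : Fin T.size)
    (v : Fin T.order) :
    T.vertexDist (R.child e) v = T.vertexDist (R.par (R.child e)) v + T.len e ∨
    T.vertexDist (R.par (R.child e)) v = T.vertexDist (R.child e) v + T.len e := by
  classical
  have key : T.vertexDist (R.child e) v - T.vertexDist (R.par (R.child e)) v =
      if R.Below (R.child e) v then - T.len e else T.len e := by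
    rw [R.vertexDist_eq, R.vertexDist_eq, ← Finset.sum_sub_distrib, Finset.sum_eq_single e]
    · have := R.not_below_par (R.child_ne_root e)
      have := R.below_refl (R.child e)
      by_cases h : R.Below (R.child e) v <;> simp [*]
    · intro e' _ he'
      have : R.Below (R.child e') (R.child e) ↔ R.Below (R.child e') (R.par (R.child e)) := by
        rw [R.below_iff_par (u := R.child e)]
        simp [R.child_injective.ne he'.symm]
      simp [this]
    · simp
  split_ifs at key
  · right; linarith
  · left; linarith

/-- The distances of the two ends from `v` differ by exactly `T.len e`, so the minimum is always
attained through the same end, whatever `t` is. This makes the distance affine in `t`. -/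
theorem dist_onEdge (T : LengthTree) (e : Fin T.size) (t : ℝ) (ht : t ∈ Set.Icc 0 (T.len e))
    (v : Fin T.order) : T.dist (.onEdge e t ht) v =
      (1 - t / T.len e) * T.vertexDist (T.src e) v + t / T.len e * T.vertexDist (T.tgt e) v := by
  obtain ⟨R⟩ := T.nonempty_rooting
  have hl := T.len_pos e
  have key : T.vertexDist (T.src e) v = T.vertexDist (T.tgt e) v + T.len e ∨
      T.vertexDist (T.tgt e) v = T.vertexDist (T.src e) v + T.len e := by
    rcases R.ends e with ⟨h, h'⟩ | ⟨h, h'⟩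
    · rw [h, h']; exact R.vertexDist_child e v
    · rw [h, h']; exact (R.vertexDist_child e v).symm
  simp only [dist]
  obtain ⟨h0, h1⟩ := ht
  rcases key with h | h
  · rw [h, min_eq_right (by linarith)]
    field_simp
    ring
  · rw [h, min_eq_left (by linarith)]
    field_simp
    ring

end LengthTree

namespace Instance

variable {I : Instance} (R : I.T.Rooting)

open Classical in
/-- A vertex that lies on the heavier side of every edge is a median. -/
theorem isMedian_of_heavy {i : Fin I.n} {v : Fin I.T.order}
    (h : ∀ c, c ≠ R.root → (R.Below c v → 1 / 2 ≤ I.mass i (R.Below c)) ∧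
      (¬ R.Below c v → I.mass i (R.Below c) ≤ 1 / 2)) : I.IsMedian i (.vertex v) := by
  have hv : ∀ u, ∑ k with I.owner k = i, I.prob k * I.T.vertexDist v (I.loc k) ≤
      ∑ k with I.owner k = i, I.prob k * I.T.vertexDist u (I.loc k) := by
    intro u
    -- Compare the two sums edge by edge: `v` pays the mass of the lighter side on every edge.
    rw [sum_prob_mul_vertexDist R, sum_prob_mul_vertexDist R]
    refine Finset.sum_le_sum fun e _ => mul_le_mul_of_nonneg_left ?_ (I.T.len_pos e).le
    have := h _ (R.child_ne_root e)
    by_cases h1 : R.Below (R.child e) v <;> by_cases h2 : R.Below (R.child e) u <;>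
      simp only [h1, h2, if_true, if_false, true_imp_iff, not_true_eq_false, false_imp_iff,
        not_false_eq_true, and_true, true_and] at this ⊢ <;> linarith
  intro y
  refine mul_le_mul_of_nonneg_left ?_ (I.weight_nonneg i)
  cases y with
  | vertex u => exact hv u
  | onEdge e t ht =>
    have h0 : 0 ≤ t / I.T.len e := div_nonneg ht.1 (I.T.len_pos e).le
    have h1 : t / I.T.len e ≤ 1 := (div_le_one (I.T.len_pos e)).2 ht.2
    have hsum : ∑ k with I.owner k = i, I.prob k * I.T.dist (.onEdge e t ht) (I.loc k) =
        (1 - t / I.T.len e) *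
          ∑ k with I.owner k = i, I.prob k * I.T.vertexDist (I.T.src e) (I.loc k) +
        t / I.T.len e *
          ∑ k with I.owner k = i, I.prob k * I.T.vertexDist (I.T.tgt e) (I.loc k) := by
      simp only [LengthTree.dist_onEdge, Finset.mul_sum, ← Finset.sum_add_distrib]
      exact Finset.sum_congr rfl fun k _ => by ring
    rw [hsum]
    have a := hv (I.T.src e)
    have b := hv (I.T.tgt e)
    simp only [LengthTree.dist] at *
    nlinarith [mul_le_mul_of_nonneg_left a (sub_nonneg.2 h1), mul_le_mul_of_nonneg_left b h0]

end Instance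

end UncertainTree

/-! ### A calculus for correctness and running time of programs. -/

namespace RealRAM

namespace Memory

@[simp] theorem writeNat_nat (m : Memory) (a i x b j : ℕ) :
    (m.writeNat a i x).nat b j = if b = a ∧ j = i then x else m.nat b j := by
  by_cases h : b = a
  · subst h
    by_cases h' : j = i <;> simp [writeNat, h']
  · simp [writeNat, h]

@[simp] theorem writeNat_real (m : Memory) (a i x : ℕ) : (m.writeNat a i x).real = m.real := rfl

@[simp] theorem writeReal_real (m : Memory) (a i : ℕ) (x : ℝ) (b j : ℕ) :
    (m.writeReal a i x).real b j = if b = a ∧ j = i then x else m.real b j := by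
  by_cases h : b = a
  · subst h
    by_cases h' : j = i <;> simp [writeReal, h']
  · simp [writeReal, h]

@[simp] theorem writeReal_nat (m : Memory) (a i : ℕ) (x : ℝ) : (m.writeReal a i x).nat = m.nat :=
  rfl

end Memory

attribute [simp] NatExpr.eval RealExpr.eval Test.Holds

/-- The contents of cell `0` of the array `a`, used as a variable. -/
abbrev NatExpr.var (a : ℕ) : NatExpr := .get a (.const 0)

namespace Program

/-- Programs without loops. -/
def straight : Program → Bool
  | skip => true
  | setNat _ _ _ => true
  | setReal _ _ _ => true
  | seq p q => p.straight && q.straight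
  | ite _ p q => p.straight && q.straight
  | loop _ _ => false

open Classical in
/-- The effect of a program without loops. -/
@[simp] noncomputable def exec : Program → Memory → Memory
  | skip, m => m
  | setNat a i x, m => m.writeNat a (i.eval m) (x.eval m)
  | setReal a i x, m => m.writeReal a (i.eval m) (x.eval m)
  | seq p q, m => q.exec (p.exec m)
  | ite b p q, m => if b.Holds m then p.exec m else q.exec m
  | loop _ _, m => m

/-- An upper bound of the running time of a program without loops. -/
def cost : Program → ℕ
  | skip => 1
  | setNat _ i x => i.cost + x.cost + 1
  | setReal _ i x => i.cost + x.cost + 1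
  | seq p q => p.cost + q.cost
  | ite b p q => b.cost + (p.cost + q.cost) + 1
  | loop _ _ => 0

/-- Does the program write into the natural-number array `a`? -/
def writesNat (a : ℕ) : Program → Bool
  | skip => false
  | setNat b _ _ => a == b
  | setReal _ _ _ => false
  | seq p q => p.writesNat a || q.writesNat a
  | ite _ p q => p.writesNat a || q.writesNat a
  | loop _ p => p.writesNat a

/-- Does the program write into the real-number array `a`? -/
def writesReal (a : ℕ) : Program → Bool
  | skip => false
  | setNat _ _ _ => false
  | setReal b _ _ => a == b
  | seq p q => p.writesReal a || q.writesReal a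
  | ite _ p q => p.writesReal a || q.writesReal a
  | loop _ p => p.writesReal a

/-- The two memories agree on all arrays into which the program does not write. -/
structure Frame (p : Program) (m m' : Memory) : Prop where
  nat : ∀ a, p.writesNat a = false → m'.nat a = m.nat a
  real : ∀ a, p.writesReal a = false → m'.real a = m.real a

theorem Frame.refl (p : Program) (m : Memory) : p.Frame m m := ⟨fun _ _ => rfl, fun _ _ => rfl⟩

theorem Frame.trans {p : Program} {m m' m'' : Memory} (h : p.Frame m m') (h' : p.Frame m' m'') :
    p.Frame m m'' :=
  ⟨fun a ha => (h'.nat a ha).trans (h.nat a ha), fun a ha => (h'.real a ha).trans (h.real a ha)⟩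

theorem Frame.mono {p q : Program} {m m' : Memory} (h : p.Frame m m')
    (hn : ∀ a, q.writesNat a = false → p.writesNat a = false)
    (hr : ∀ a, q.writesReal a = false → p.writesReal a = false) : q.Frame m m' :=
  ⟨fun a ha => h.nat a (hn a ha), fun a ha => h.real a (hr a ha)⟩

end Program

/-- Whether an array is written is a Boolean computed from the program text, so preservation of an
array by a concrete program is settled by `rfl`. -/
theorem Runs.frame {p : Program} {m m' : Memory} {t : ℕ} (h : Runs p m t m') : p.Frame m m' := by
  induction h with
  | skip m => exact .refl _ _
  | setNat a i x m =>
    refine ⟨fun b hb => ?_, fun _ _ => rfl⟩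
    have hb' : b ≠ a := by simpa [Program.writesNat] using hb
    simp [Memory.writeNat, hb']
  | setReal a i x m =>
    refine ⟨fun _ _ => rfl, fun b hb => ?_⟩
    have hb' : b ≠ a := by simpa [Program.writesReal] using hb
    simp [Memory.writeReal, hb']
  | seq _ _ ih ih' =>
    exact (ih.mono (by simp +contextual [Program.writesNat])
      (by simp +contextual [Program.writesReal])).trans
      (ih'.mono (by simp +contextual [Program.writesNat])
      (by simp +contextual [Program.writesReal]))
  | ite_true q _ _ ih =>
    exact ih.mono (by simp +contextual [Program.writesNat])
      (by simp +contextual [Program.writesReal])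
  | ite_false q _ _ ih =>
    exact ih.mono (by simp +contextual [Program.writesNat])
      (by simp +contextual [Program.writesReal])
  | loop_done => exact .refl _ _
  | loop_step _ _ _ ih ih' =>
    exact Program.Frame.trans (p := .loop _ _) (ih.mono (fun _ h => h) (fun _ h => h)) ih'

/-- Started on `m`, the program halts within `t` steps, with a memory that satisfies `Q`. -/
def Reach (p : Program) (m : Memory) (t : ℕ) (Q : Memory → Prop) : Prop :=
  ∃ s m', Runs p m s m' ∧ s ≤ t ∧ Q m'

theorem Reach.frame {p : Program} {m : Memory} {t : ℕ} {Q : Memory → Prop} (h : Reach p m t Q) :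
    Reach p m t (fun m' => p.Frame m m' ∧ Q m') := by
  obtain ⟨s, m', h1, h2, h3⟩ := h
  exact ⟨s, m', h1, h2, h1.frame, h3⟩

theorem Reach.mono {p : Program} {m : Memory} {t t' : ℕ} {Q Q' : Memory → Prop}
    (h : Reach p m t Q) (ht : t ≤ t') (hQ : ∀ m', p.Frame m m' → Q m' → Q' m') :
    Reach p m t' Q' := by
  obtain ⟨s, m', h1, h2, h3⟩ := h
  exact ⟨s, m', h1, h2.trans ht, hQ _ h1.frame h3⟩

theorem Reach.seq {p q : Program} {m : Memory} {s t : ℕ} {Q Q' : Memory → Prop}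
    (h : Reach p m s Q') (h' : ∀ m', p.Frame m m' → Q' m' → Reach q m' t Q) :
    Reach (.seq p q) m (s + t) Q := by
  obtain ⟨s', m', h1, h2, h3⟩ := h
  obtain ⟨t', m'', h4, h5, h6⟩ := h' m' h1.frame h3
  exact ⟨_, _, .seq h1 h4, by omega, h6⟩

theorem Program.runs_exec (p : Program) (hp : p.straight = true) (m : Memory) :
    ∃ s, Runs p m s (p.exec m) ∧ s ≤ p.cost := by
  induction p generalizing m with
  | skip => exact ⟨_, .skip m, le_rfl⟩
  | setNat a i x => exact ⟨_, .setNat a i x m, le_rfl⟩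
  | setReal a i x => exact ⟨_, .setReal a i x m, le_rfl⟩
  | seq p q ihp ihq =>
    simp only [straight, Bool.and_eq_true] at hp
    obtain ⟨s, h, hs⟩ := ihp hp.1 m
    obtain ⟨t, h', ht⟩ := ihq hp.2 (p.exec m)
    exact ⟨_, .seq h h', Nat.add_le_add hs ht⟩
  | ite b p q ihp ihq =>
    simp only [straight, Bool.and_eq_true] at hp
    by_cases hb : b.Holds m
    · obtain ⟨s, h, hs⟩ := ihp hp.1 m
      exact ⟨_, by rw [exec, if_pos hb]; exact .ite_true q hb h, by simp only [cost]; omega⟩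
    · obtain ⟨s, h, hs⟩ := ihq hp.2 m
      exact ⟨_, by rw [exec, if_neg hb]; exact .ite_false p hb h, by simp only [cost]; omega⟩
  | loop => simp [straight] at hp

theorem Reach.straight {p : Program} (hp : p.straight = true) {m : Memory} {Q : Memory → Prop}
    (h : Q (p.exec m)) : Reach p m p.cost Q := by
  obtain ⟨s, h1, h2⟩ := p.runs_exec hp m
  exact ⟨s, _, h1, h2, h⟩

/-- The loop rule for a known number `n` of iterations. Each step may use the frame relative to the
initial memory, so an invariant need only mention the arrays that change. -/
theorem Reach.loop {b : Test} {p : Program} {m₀ : Memory} (Inv : ℕ → Memory → Prop) (n c : ℕ)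
    (start : Inv 0 m₀)
    (step : ∀ j < n, ∀ m, p.Frame m₀ m → Inv j m → b.Holds m ∧ Reach p m c (Inv (j + 1)))
    (last : ∀ m, p.Frame m₀ m → Inv n m → ¬ b.Holds m) :
    Reach (.loop b p) m₀ (n * (c + b.cost + 1) + (b.cost + 1)) (Inv n) := by
  have key : ∀ k j m, j + k = n → p.Frame m₀ m → Inv j m →
      Reach (.loop b p) m (k * (c + b.cost + 1) + (b.cost + 1)) (Inv n) := by
    intro k
    induction k with
    | zero =>
      intro j m hj hF hI
      obtain rfl : j = n := hj
      exact ⟨_, m, .loop_done p (last m hF hI), by omega, hI⟩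
    | succ k ih =>
      intro j m hj hF hI
      obtain ⟨hb, s, m', h1, h2, h3⟩ := step j (by omega) m hF hI
      obtain ⟨t, m'', h4, h5, h6⟩ := ih (j + 1) m' (by omega) (hF.trans h1.frame) h3
      refine ⟨_, m'', .loop_step hb h1 h4, ?_, h6⟩
      rw [Nat.succ_mul]
      omega
  exact key n 0 m₀ (by omega) (.refl _ _) start

end RealRAM

/-! ### Degrees and neighbour sums. -/

set_option linter.unusedSimpArgs false

theorem Fin.sum_lt_succ {α : Type*} [AddCommMonoid α] {n : ℕ} (f : Fin n → α) (j : Fin n) :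
    ∑ e : Fin n with e.val < j.val + 1, f e = ∑ e : Fin n with e.val < j.val, f e + f j := by
  have : (Finset.univ.filter fun e : Fin n => (e : ℕ) < j + 1) =
      insert j (Finset.univ.filter fun e : Fin n => (e : ℕ) < j) := by
    ext e
    simp only [Finset.mem_filter, Finset.mem_univ, true_and, Finset.mem_insert, Fin.ext_iff]
    omega
  rw [this, Finset.sum_insert (by simp), add_comm]

namespace UncertainTree

open RealRAM

/-- The part of the memory that holds the input. -/
structure Instance.Stored (I : Instance) (m : Memory) : Prop where
  order : m.nat 0 0 = I.T.order
  size : m.nat 0 1 = I.T.size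
  n : m.nat 0 2 = I.n
  M : m.nat 0 3 = I.M
  src : ∀ e : Fin I.T.size, m.nat 1 e = I.T.src e
  tgt : ∀ e : Fin I.T.size, m.nat 2 e = I.T.tgt e
  owner : ∀ k : Fin I.M, m.nat 3 k = I.owner k
  loc : ∀ k : Fin I.M, m.nat 4 k = I.loc k
  prob : ∀ k : Fin I.M, m.real 1 k = I.prob k

theorem Instance.stored_input (I : Instance) : I.Stored I.input := by
  constructor <;> intros <;> simp [Instance.input, toArray]

theorem Instance.Stored.frame {I : Instance} {p : Program} {m m' : Memory} (h : I.Stored m)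
    (hF : p.Frame m m') (h0 : p.writesNat 0 = false) (h1 : p.writesNat 1 = false)
    (h2 : p.writesNat 2 = false) (h3 : p.writesNat 3 = false) (h4 : p.writesNat 4 = false)
    (h5 : p.writesReal 1 = false) : I.Stored m' := by
  constructor
  · rw [hF.nat 0 h0, h.order]
  · rw [hF.nat 0 h0, h.size]
  · rw [hF.nat 0 h0, h.n]
  · rw [hF.nat 0 h0, h.M]
  · rw [hF.nat 1 h1]; exact h.src
  · rw [hF.nat 2 h2]; exact h.tgt
  · rw [hF.nat 3 h3]; exact h.owner
  · rw [hF.nat 4 h4]; exact h.loc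
  · rw [hF.real 1 h5]; exact h.prob

namespace Code

open NatExpr

/-- Count the neighbours of every vertex, and add up their numbers. -/
def degreeBody : Program :=
  .seq (.setNat 6 (.get 1 (var 20)) (.add (.get 6 (.get 1 (var 20))) (.const 1))) <|
  .seq (.setNat 6 (.get 2 (var 20)) (.add (.get 6 (.get 2 (var 20))) (.const 1))) <|
  .seq (.setNat 7 (.get 1 (var 20)) (.add (.get 7 (.get 1 (var 20))) (.get 2 (var 20)))) <|
  .seq (.setNat 7 (.get 2 (var 20)) (.add (.get 7 (.get 2 (var 20))) (.get 1 (var 20)))) <|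
  .setNat 20 (.const 0) (.add (var 20) (.const 1))

/-- The initial count 1 of the vertex 0 stands in for the parent that the root lacks. With it every
vertex, the root included, counts one more than the number of its children. -/
def degreeInit : Program :=
  .seq (.setNat 20 (.const 0) (.const 0)) (.setNat 6 (.const 0) (.const 1))

def degree : Program :=
  .seq degreeInit (.loop (.natLt (var 20) (.get 0 (.const 1))) degreeBody)

end Code

/-- The children of `v`. -/
def LengthTree.Rooting.children {T : LengthTree} (R : T.Rooting) (v : Fin T.order) :
    Finset (Fin T.order) := Finset.univ.filter fun c => c ≠ R.root ∧ R.par c = v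

theorem reach_degree : ∃ K : ℕ, ∀ {I : Instance} (R : I.T.Rooting) (m : Memory), I.Stored m →
    m.nat 6 = (fun _ => 0) → m.nat 7 = (fun _ => 0) →
    Reach Code.degree m (K * (I.T.size + 1)) fun m' =>
      (∀ v : Fin I.T.order, m'.nat 6 v = 1 + (R.children v).card) ∧
      (∀ v : Fin I.T.order, m'.nat 7 v = R.par v + ∑ c ∈ R.children v, (c : ℕ)) := by
  -- The 20 generously covers the loop tests and the overhead of an iteration; the same constant
  -- serves the later loops.
  refine ⟨Code.degreeInit.cost + Code.degreeBody.cost + 20, fun {I} R m hS h6 h7 => ?_⟩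
  refine (Reach.seq (Q' := fun m' => m'.nat 20 0 = 0 ∧
      (∀ v : Fin I.T.order, m'.nat 6 v = if v = R.root then 1 else 0) ∧ m'.nat 7 = fun _ => 0)
    (Reach.straight rfl ?_) (Q := fun m' => m'.nat 20 0 = I.T.size ∧
    (∀ v : Fin I.T.order, m'.nat 6 v = (if v = R.root then 1 else 0) +
      ∑ e : Fin I.T.size with e.val < I.T.size, ((if I.T.src e = v then 1 else 0) +
        (if I.T.tgt e = v then 1 else 0))) ∧
    (∀ v : Fin I.T.order, m'.nat 7 v =
      ∑ e : Fin I.T.size with e.val < I.T.size, ((if I.T.src e = v then (I.T.tgt e : ℕ) else 0) +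
        (if I.T.tgt e = v then (I.T.src e : ℕ) else 0))))
    fun m₁ hF h => Reach.loop (fun j m' => m'.nat 20 0 = j ∧
      (∀ v : Fin I.T.order, m'.nat 6 v = (if v = R.root then 1 else 0) +
        ∑ e : Fin I.T.size with e.val < j, ((if I.T.src e = v then 1 else 0) +
          (if I.T.tgt e = v then 1 else 0))) ∧
      (∀ v : Fin I.T.order, m'.nat 7 v =
        ∑ e : Fin I.T.size with e.val < j, ((if I.T.src e = v then (I.T.tgt e : ℕ) else 0) +
          (if I.T.tgt e = v then (I.T.src e : ℕ) else 0)))) _ Code.degreeBody.cost ?_ ?_ ?_).mono ?_ ?_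
  · simp [Code.degreeInit, h6, h7, Fin.ext_iff, R.root_val]
    funext j; simp [h7]
  · simpa [h.1, h.2.2] using h.2.1
  · rintro j hj m₂ hF₂ ⟨h20, hd, hs⟩
    have hS₂ := (hS.frame hF rfl rfl rfl rfl rfl rfl).frame hF₂ rfl rfl rfl rfl rfl rfl
    have e1 := hS₂.src ⟨j, hj⟩
    have e2 := hS₂.tgt ⟨j, hj⟩
    have hne := I.T.src_ne_tgt ⟨j, hj⟩
    simp only at e1 e2
    refine ⟨by simp [h20, hS₂.size, hj], Reach.straight rfl ⟨?_, fun v => ?_, fun v => ?_⟩⟩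
    · simp [Code.degreeBody, h20]
    · rw [Fin.sum_lt_succ _ ⟨j, hj⟩]
      simp only [Code.degreeBody, Program.exec, NatExpr.eval, Memory.writeNat_nat]
      simp [h20, e1, e2, hd, ← Fin.ext_iff, hne, hne.symm]
      by_cases hv : v = I.T.src ⟨j, hj⟩
      · subst hv; simp [hne, hne.symm, add_assoc]
      · by_cases hv' : v = I.T.tgt ⟨j, hj⟩
        · subst hv'; simp [hne, hne.symm, add_assoc]
        · simp [hv, hv', Ne.symm hv, Ne.symm hv', eq_comm]
    · rw [Fin.sum_lt_succ _ ⟨j, hj⟩]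
      simp only [Code.degreeBody, Program.exec, NatExpr.eval, Memory.writeNat_nat]
      simp [h20, e1, e2, hs, ← Fin.ext_iff, hne, hne.symm]
      by_cases hv : v = I.T.src ⟨j, hj⟩
      · subst hv; simp [hne, hne.symm, add_assoc]
      · by_cases hv' : v = I.T.tgt ⟨j, hj⟩
        · subst hv'; simp [hne, hne.symm, add_assoc]
        · simp [hv, hv', Ne.symm hv, Ne.symm hv', eq_comm]
  · rintro m₂ hF₂ ⟨h20, -, -⟩
    have hS₂ := (hS.frame hF rfl rfl rfl rfl rfl rfl).frame hF₂ rfl rfl rfl rfl rfl rfl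
    simp [h20, hS₂.size]
  · simp only [Test.cost, NatExpr.cost]
    nlinarith
  · rintro m' - ⟨-, hd, hs⟩
    simp only [Fin.is_lt, Finset.filter_true] at hd hs
    constructor
    · intro v
      -- Orient every edge from child to parent, which turns the sum over edges into one over the
      -- vertices other than the root. Such a vertex gets its own parent edge once and one
      -- contribution from each child.
      rw [hd, Finset.sum_congr rfl (g := fun e => (if R.child e = v then 1 else 0) +
        (if R.par (R.child e) = v then 1 else 0))]
      · rw [← R.sum_ne_root_eq_sum_edges (fun c => (if c = v then 1 else 0) +
          (if R.par c = v then 1 else 0)), Finset.sum_add_distrib, LengthTree.Rooting.children,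
          Finset.card_filter, Finset.sum_filter, Finset.sum_filter]
        simp only [← ite_and]
        rw [← add_assoc]
        congr 1
        by_cases hv : v = R.root
        · subst hv
          rw [Finset.sum_eq_zero]
          · simp
          · rintro c -; rw [if_neg]; tauto
        · rw [Finset.sum_eq_single v] <;> simp +contextual [hv]
      · intro e _
        rcases R.ends e with ⟨h, h'⟩ | ⟨h, h'⟩
        · rw [h, h']
        · rw [h, h', add_comm]
    · intro v
      rw [hs, Finset.sum_congr rfl (g := fun e =>
        (if R.child e = v then (R.par (R.child e) : ℕ) else 0) +
        (if R.par (R.child e) = v then (R.child e : ℕ) else 0))]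
      · rw [← R.sum_ne_root_eq_sum_edges (fun c => (if c = v then (R.par c : ℕ) else 0) +
          (if R.par c = v then (c : ℕ) else 0)), Finset.sum_add_distrib,
          LengthTree.Rooting.children, Finset.sum_filter, Finset.sum_filter, Finset.sum_filter]
        simp only [← ite_and]
        congr 1
        by_cases hv : v = R.root
        · subst hv
          -- The root is its own parent and has the number 0, so the absence of a parent does not
          -- affect the sum.
          rw [Finset.sum_eq_zero, R.par_root, R.root_val]
          rintro c -; rw [if_neg]; tauto
        · rw [Finset.sum_eq_single v] <;> simp +contextual [hv]
      · intro e _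
        rcases R.ends e with ⟨h, h'⟩ | ⟨h, h'⟩
        · rw [h, h']
        · rw [h, h', add_comm]

end UncertainTree

/-! ### Stripping leaves: parents, subtree sizes and relative positions. -/

namespace UncertainTree

open RealRAM

theorem _root_.RealRAM.Memory.writeNat_nat_array (m : Memory) (a i x b : ℕ) :
    (m.writeNat a i x).nat b = if b = a then Function.update (m.nat b) i x else m.nat b := by
  by_cases h : b = a
  · subst h; simp [Memory.writeNat]
  · simp [Memory.writeNat, h]

theorem LengthTree.Rooting.mem_children {T : LengthTree} {R : T.Rooting} {c v : Fin T.order} :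
    c ∈ R.children v ↔ c ≠ R.root ∧ R.par c = v := by
  simp [LengthTree.Rooting.children]

/-- The state of the stripping of leaves after `h` rounds: the set `D` of the vertices that are
stripped consists of the first `h` entries of the queue `q`, which has `t` entries altogether,
namely the vertices all of whose children are stripped. Every stripped vertex `c` has got an interval
of length `size c` at position `off c` inside the interval of its parent. -/
structure StripInv {T : LengthTree} (R : T.Rooting) (D : Finset (Fin T.order)) (h t : ℕ)
    (q deg par size off : ℕ → ℕ) : Prop where
  card : D.card = h
  mem_D : ∀ v, v ∈ D ↔ ∃ j < h, q j = v
  le : h ≤ t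
  lt_order : ∀ j < t, q j < T.order
  inj : ∀ j < t, ∀ j' < t, q j = q j' → j = j'
  mem_q : ∀ v : Fin T.order, (∃ j < t, q j = v) ↔ R.children v ⊆ D
  deg_eq : ∀ v : Fin T.order, deg v = 1 + (R.children v \ D).card
  par_eq : ∀ v : Fin T.order, par v = R.par v + ∑ c ∈ R.children v \ D, (c : ℕ)
  topo : ∀ j < h, ∀ j' ≤ j, ∀ v : Fin T.order, q j = v → q j' ≠ R.par v
  ne_root : R.root ∉ D
  size_pos : ∀ v : Fin T.order, 1 ≤ size v
  off_pos : ∀ c ∈ D, 1 ≤ off c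
  off_le : ∀ c ∈ D, off c + size c ≤ size (R.par c)
  off_disj : ∀ c ∈ D, ∀ c' ∈ D, R.par c = R.par c' → c ≠ c' →
    off c + size c ≤ off c' ∨ off c' + size c' ≤ off c
  total : ∑ v ∈ Dᶜ, size v = T.order

section

variable {T : LengthTree} {R : T.Rooting} {D : Finset (Fin T.order)} {h t : ℕ}
  {q deg par size off : ℕ → ℕ}

theorem StripInv.children_subset (H : StripInv R D h t q deg par size off) {v : Fin T.order}
    (hv : v ∈ D) : R.children v ⊆ D := by
  obtain ⟨j, hj, h1⟩ := (H.mem_D v).1 hv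
  exact (H.mem_q v).1 ⟨j, hj.trans_le H.le, h1⟩

/-- A deepest unstripped vertex other than the root has only stripped children, so it is in the
queue beyond the first `h` entries; hence the queue is not exhausted. -/
theorem StripInv.exists_head (H : StripInv R D h t q deg par size off) (hh : h + 1 < T.order) :
    ∃ V : Fin T.order, h < t ∧ q h = V ∧ V ∉ D ∧ V ≠ R.root ∧ R.children V ⊆ D := by
  have hne : ((insert R.root D)ᶜ).Nonempty := by
    rw [← Finset.card_pos, Finset.card_compl, Finset.card_insert_of_notMem H.ne_root, H.card]
    simp
    omega
  obtain ⟨w, hw, hmax⟩ := Finset.exists_max_image _ R.depth hne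
  simp only [Finset.mem_compl, Finset.mem_insert, not_or] at hw hmax
  obtain ⟨j, hj, hqj⟩ := (H.mem_q w).2 (by
    intro c hc
    obtain ⟨h1, rfl⟩ := LengthTree.Rooting.mem_children.1 hc
    by_contra hcD
    have := hmax c ⟨h1, hcD⟩
    have := R.depth_par c h1
    omega)
  have hhj : h ≤ j := by
    by_contra hlt
    exact hw.2 ((H.mem_D w).2 ⟨j, by omega, hqj⟩)
  have hht : h < t := by omega
  obtain ⟨V, hV⟩ : ∃ V : Fin T.order, q h = V := ⟨⟨q h, H.lt_order h hht⟩, rfl⟩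
  have hVc : R.children V ⊆ D := (H.mem_q V).1 ⟨h, hht, hV⟩
  refine ⟨V, hht, hV, ?_, ?_, hVc⟩
  · intro hVD
    obtain ⟨j', hj', h1⟩ := (H.mem_D V).1 hVD
    have := H.inj j' (by omega) h hht (h1.trans hV.symm)
    omega
  · rintro rfl
    -- If all children of the root were stripped, then by descent so would be every vertex other
    -- than the root, contrary to the choice of `w`.
    have key : ∀ k, ∀ u, R.depth u = k → u ≠ R.root → u ∈ D := by
      intro k
      induction k with
      | zero => exact fun u hu h0 => absurd (R.eq_root_of_depth hu) h0
      | succ k ih =>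
        intro u hu h0
        by_cases hp : R.par u = R.root
        · exact hVc (LengthTree.Rooting.mem_children.2 ⟨h0, hp⟩)
        · have := R.depth_par u h0
          exact H.children_subset (ih _ (by omega) hp) (LengthTree.Rooting.mem_children.2 ⟨h0, rfl⟩)
    exact hw.2 (key _ w rfl hw.1)

/-- Stripping `V` affects only its parent `p`. The block of `V` is appended to the part of the
interval of `p` already in use, so it is disjoint from the blocks of the children stripped before;
the first place of the interval is left to `p` itself. The vertex `p` joins the queue exactly when
`V` was its last unstripped child. -/
theorem StripInv.step (H : StripInv R D h t q deg par size off) {V : Fin T.order}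
    (hht : h < t) (hV : q h = V) (hVD : V ∉ D) (hVr : V ≠ R.root) (hVc : R.children V ⊆ D)
    {p : Fin T.order} (hp : R.par V = p) :
    StripInv R (insert V D) (h + 1) (if deg p - 1 = 1 then t + 1 else t)
      (if deg p - 1 = 1 then Function.update q t p else q)
      (Function.update deg p (deg p - 1)) (Function.update par p (par p - V))
      (Function.update size p (size p + size V)) (Function.update off V (size p)) := by
  have hdep := R.depth_par V hVr
  have hpV : p ≠ V := by rintro rfl; rw [hp] at hdep; omega
  have hVp : V ∈ R.children p := LengthTree.Rooting.mem_children.2 ⟨hVr, hp⟩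
  have hpD : p ∉ D := fun hpD => hVD (H.children_subset hpD hVp)
  have hVp' : V ∈ R.children p \ D := Finset.mem_sdiff.2 ⟨hVp, hVD⟩
  -- The parent is not yet in the queue, because its child `V` is still unstripped.
  have hpq : ∀ j < t, q j ≠ p := fun j hj hqj => hVD ((H.mem_q p).1 ⟨j, hj, hqj⟩ hVp)
  have hsd : ∀ u, R.children u \ insert V D = (R.children u \ D).erase V := by
    intro u; ext x; simp only [Finset.mem_sdiff, Finset.mem_insert, Finset.mem_erase]; tauto
  have hsd' : ∀ u, u ≠ p → R.children u \ insert V D = R.children u \ D := by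
    intro u hu
    rw [hsd, Finset.erase_eq_of_notMem]
    intro hx
    exact hu ((LengthTree.Rooting.mem_children.1 (Finset.mem_sdiff.1 hx).1).2.symm.trans hp)
  have hcard := Finset.card_erase_add_one hVp'
  have hdeg := H.deg_eq p
  have hpush : deg p - 1 = 1 ↔ R.children p ⊆ insert V D := by
    rw [← Finset.sdiff_eq_empty_iff_subset, ← Finset.card_eq_zero, hsd]
    omega
  set q' := if deg p - 1 = 1 then Function.update q t p else q with hq'
  set t' := if deg p - 1 = 1 then t + 1 else t with ht'
  have hqq : ∀ j < t, q' j = q j := by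
    intro j hj
    rw [hq']; split_ifs
    · rw [Function.update_of_ne (by omega)]
    · rfl
  have htt : t ≤ t' := by rw [ht']; split_ifs <;> omega
  have hq : ∀ j < t', j < t ∨ (j = t ∧ q' j = p ∧ deg p - 1 = 1) := by
    intro j hj
    rw [ht'] at hj
    split_ifs at hj with hd
    · rcases Nat.lt_succ_iff_lt_or_eq.1 hj with h1 | rfl
      · exact .inl h1
      · right; simp [hq', hd]
    · exact .inl hj
  have hmem : ∀ v, v ∈ insert V D ↔ ∃ j < h + 1, q' j = v := by
    intro v
    rw [Finset.mem_insert, H.mem_D]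
    constructor
    · rintro (rfl | ⟨j, hj, h1⟩)
      · exact ⟨h, by omega, by rw [hqq _ hht, hV]⟩
      · exact ⟨j, by omega, by rw [hqq _ (by omega), h1]⟩
    · rintro ⟨j, hj, h1⟩
      rw [hqq _ (by omega)] at h1
      rcases Nat.lt_succ_iff_lt_or_eq.1 hj with h2 | rfl
      · exact .inr ⟨j, h2, h1⟩
      · left; ext; rw [← h1, hV]
  have hle := H.le
  have hsizep : ∀ c : Fin T.order, c ≠ p →
      Function.update size p (size p + size V) (c : ℕ) = size c := by
    intro c hc
    rw [Function.update_of_ne (by rwa [Ne, Fin.val_inj])]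
  have hoffV : ∀ c : Fin T.order, c ≠ V → Function.update off V (size p) (c : ℕ) = off c := by
    intro c hc
    rw [Function.update_of_ne (by rwa [Ne, Fin.val_inj])]
  have hDne : ∀ c ∈ D, c ≠ V ∧ c ≠ p := fun c hc =>
    ⟨by rintro rfl; exact hVD hc, by rintro rfl; exact hpD hc⟩
  refine ⟨?_, hmem, ?_, ?_, ?_, ?_, ?_, ?_, ?_, ?_, ?_, ?_, ?_, ?_, ?_⟩
  · rw [Finset.card_insert_of_notMem hVD, H.card]
  · omega
  · intro j hj
    rcases hq j hj with h1 | ⟨-, h1, -⟩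
    · rw [hqq j h1]; exact H.lt_order j h1
    · rw [h1]; exact p.isLt
  · intro j hj j' hj' hjj
    rcases hq j hj with h1 | ⟨h1, h2, -⟩ <;> rcases hq j' hj' with h1' | ⟨h1', h2', -⟩
    · rw [hqq j h1, hqq j' h1'] at hjj; exact H.inj j h1 j' h1' hjj
    · rw [hqq j h1, h2'] at hjj; exact absurd hjj (hpq j h1)
    · rw [hqq j' h1', h2] at hjj; exact absurd hjj.symm (hpq j' h1')
    · omega
  · intro v
    by_cases hv : v = p
    · subst hv
      rw [← hpush]
      constructor
      · rintro ⟨j, hj, h1⟩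
        rcases hq j hj with h2 | ⟨-, -, h2⟩
        · rw [hqq j h2] at h1; exact absurd h1 (hpq j h2)
        · exact h2
      · intro hd
        exact ⟨t, by simp [ht', hd], by simp [hq', hd]⟩
    · rw [← Finset.sdiff_eq_empty_iff_subset, hsd' v hv, Finset.sdiff_eq_empty_iff_subset,
        ← H.mem_q v]
      constructor
      · rintro ⟨j, hj, h1⟩
        rcases hq j hj with h2 | ⟨-, h2, -⟩
        · exact ⟨j, h2, by rw [← hqq j h2, h1]⟩
        · exact absurd (Fin.ext (h1.symm.trans h2)) hv
      · rintro ⟨j, hj, h1⟩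
        exact ⟨j, by omega, by rw [hqq j hj, h1]⟩
  · intro v
    by_cases hv : v = p
    · subst hv
      rw [Function.update_self, hsd]
      omega
    · rw [Function.update_of_ne (by rwa [Ne, Fin.val_inj]), hsd' v hv, H.deg_eq]
  · intro v
    by_cases hv : v = p
    · subst hv
      have := Finset.sum_erase_add (R.children v \ D) (fun c => (c : ℕ)) hVp'
      have := H.par_eq v
      rw [Function.update_self, hsd]
      omega
    · rw [Function.update_of_ne (by rwa [Ne, Fin.val_inj]), hsd' v hv, H.par_eq]
  · intro j hj j' hj' v hv
    rw [hqq j (by omega)] at hv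
    rw [hqq j' (by omega)]
    rcases Nat.lt_succ_iff_lt_or_eq.1 hj with h1 | rfl
    · exact H.topo j h1 j' hj' v hv
    · obtain rfl : V = v := by ext; rw [← hv, hV]
      rw [hp]
      exact hpq j' (by omega)
  · simp [H.ne_root, hVr.symm]
  · intro v
    by_cases hv : v = p
    · subst hv
      rw [Function.update_self]
      have := H.size_pos v
      omega
    · rw [hsizep v hv]; exact H.size_pos v
  · intro c hc
    rcases Finset.mem_insert.1 hc with rfl | hc
    · rw [Function.update_self]; exact H.size_pos p
    · rw [hoffV c (hDne c hc).1]; exact H.off_pos c hc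
  · intro c hc
    rcases Finset.mem_insert.1 hc with rfl | hc
    · rw [Function.update_self, hp, Function.update_self, hsizep c hpV.symm]
    · rw [hoffV c (hDne c hc).1, hsizep c (hDne c hc).2]
      have h1 := H.off_le c hc
      by_cases hcp : R.par c = p
      · rw [hcp] at h1 ⊢
        rw [Function.update_self]
        omega
      · rwa [hsizep _ hcp]
  · intro c hc c' hc' hcc hne
    rcases Finset.mem_insert.1 hc with rfl | h1 <;> rcases Finset.mem_insert.1 hc' with rfl | h2
    · exact absurd rfl hne
    · right
      rw [Function.update_self, hoffV c' (hDne c' h2).1, hsizep c' (hDne c' h2).2, ← hp, hcc]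
      exact H.off_le c' h2
    · left
      rw [Function.update_self, hoffV c (hDne c h1).1, hsizep c (hDne c h1).2, ← hp, ← hcc]
      exact H.off_le c h1
    · rw [hoffV c (hDne c h1).1, hsizep c (hDne c h1).2, hoffV c' (hDne c' h2).1,
        hsizep c' (hDne c' h2).2]
      exact H.off_disj c h1 c' h2 hcc hne
  -- The size of `V` leaves the sum and reappears in the size of `p`.
  · have h1 : (insert V D)ᶜ = (Dᶜ).erase V := by
      ext x; simp only [Finset.mem_compl, Finset.mem_insert, Finset.mem_erase]; tauto
    have h2 : p ∈ (Dᶜ).erase V := by simp [hpV, hpD]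
    have h3 := Finset.sum_erase_add (Dᶜ) (fun v => size (v : ℕ)) (Finset.mem_compl.2 hVD)
    have h4 := Finset.sum_erase_add ((Dᶜ).erase V) (fun v => size (v : ℕ)) h2
    have h5 := Finset.sum_erase_add ((Dᶜ).erase V)
      (fun v => Function.update size p (size p + size V) (v : ℕ)) h2
    have h6 := Finset.sum_congr (rfl : ((Dᶜ).erase V).erase p = _)
      (fun c hc => hsizep c (Finset.ne_of_mem_erase hc))
    have h7 := H.total
    simp only [Function.update_self] at h5
    rw [h1]
    omega

end

namespace Code

open NatExpr

/-- Append the vertex in the variable `a` to the queue if it has become a leaf. -/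
def push (a : ℕ) : Program :=
  .ite (.natEq (.get 6 (var a)) (.const 1))
    (.seq (.setNat 8 (var 22) (var a)) (.setNat 22 (.const 0) (.add (var 22) (.const 1)))) .skip

def leavesInit : Program :=
  .seq (.setNat 20 (.const 0) (.const 0)) (.setNat 22 (.const 0) (.const 0))

def leavesBody : Program :=
  .seq (.setNat 9 (var 20) (.const 1)) <|
  .seq (push 20) <|
  .setNat 20 (.const 0) (.add (var 20) (.const 1))

/-- Fill the queue with all leaves. -/
def leaves : Program :=
  .seq leavesInit (.loop (.natLt (var 20) (.get 0 (.const 0))) leavesBody)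

/-- Arrays 6 to 10 hold the counts, neighbour sums, queue, sizes and offsets. Once all children of a
vertex are stripped, its neighbour sum is its parent. The offset is taken from the size of the
parent before that size grows. -/
def stripBody : Program :=
  .seq (.setNat 23 (.const 0) (.get 8 (var 21))) <|
  .seq (.setNat 24 (.const 0) (.get 7 (var 23))) <|
  .seq (.setNat 6 (var 24) (.sub (.get 6 (var 24)) (.const 1))) <|
  .seq (.setNat 7 (var 24) (.sub (.get 7 (var 24)) (var 23))) <|
  .seq (.setNat 10 (var 23) (.get 9 (var 24))) <|
  .seq (.setNat 9 (var 24) (.add (.get 9 (var 24)) (.get 9 (var 23)))) <|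
  .seq (push 24) <|
  .setNat 21 (.const 0) (.add (var 21) (.const 1))

/-- Strip off leaves until only the root is left. -/
def strip : Program :=
  .seq (.setNat 21 (.const 0) (.const 0))
    (.loop (.natLt (.add (var 21) (.const 1)) (.get 0 (.const 0))) stripBody)

end Code

theorem reach_leaves : ∃ K : ℕ, ∀ {I : Instance} (R : I.T.Rooting) (m : Memory), I.Stored m →
    (∀ v : Fin I.T.order, m.nat 6 v = 1 + (R.children v).card) →
    (∀ v : Fin I.T.order, m.nat 7 v = R.par v + ∑ c ∈ R.children v, (c : ℕ)) →
    Reach Code.leaves m (K * (I.T.order + 1)) fun m' =>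
      StripInv R ∅ 0 (m'.nat 22 0) (m'.nat 8) (m'.nat 6) (m'.nat 7) (m'.nat 9) (m'.nat 10) := by
  refine ⟨Code.leavesInit.cost + Code.leavesBody.cost + 20, fun {I} R m hS hd hp => ?_⟩
  let Inv : ℕ → Memory → Prop := fun j m' => m'.nat 20 0 = j ∧
    (∀ i < j, m'.nat 9 i = 1) ∧
    (∀ i < m'.nat 22 0, m'.nat 8 i < j) ∧
    (∀ i < m'.nat 22 0, ∀ i' < m'.nat 22 0, m'.nat 8 i = m'.nat 8 i' → i = i') ∧
    (∀ v < j, (∃ i < m'.nat 22 0, m'.nat 8 i = v) ↔ m.nat 6 v = 1)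
  refine (Reach.seq (Q' := Inv 0) (Reach.straight rfl ?_) fun m₁ hF h =>
    Reach.loop Inv I.T.order Code.leavesBody.cost h ?_ ?_).frame.mono ?_ ?_
  · simp [Inv, Code.leavesInit]
  · rintro j hj m₂ hF₂ ⟨h20, h9, hlt, hinj, hmem⟩
    have hS₂ := (hS.frame hF rfl rfl rfl rfl rfl rfl).frame hF₂ rfl rfl rfl rfl rfl rfl
    have h6 : m₂.nat 6 = m.nat 6 := (hF₂.nat 6 rfl).trans (hF.nat 6 rfl)
    refine ⟨by simp [h20, hS₂.order, hj], Reach.straight rfl ?_⟩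
    simp only [Inv, Code.leavesBody, Code.push, Program.exec, NatExpr.eval, Test.Holds,
      Memory.writeNat_nat]
    simp only [h20, h6]
    by_cases hc : m.nat 6 j = 1
    · simp [hc, h20]
      refine ⟨?_, ?_, ?_, ?_⟩
      · intro i hi hij; exact h9 i (by omega)
      · intro i hi
        split_ifs with h1
        · omega
        · have := hlt i (by omega); omega
      · intro i hi i' hi' hii
        split_ifs at hii with h1 h2 h2
        · omega
        · have := hlt i' (by omega); omega
        · have := hlt i (by omega); omega
        · exact hinj i (by omega) i' (by omega) hii
      · intro v hv
        rcases Nat.lt_succ_iff_lt_or_eq.1 (Nat.lt_succ_of_le hv) with h1 | rfl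
        · rw [← hmem v h1]
          constructor
          · rintro ⟨i, hi, h2⟩
            split_ifs at h2 with h3
            · omega
            · exact ⟨i, by omega, h2⟩
          · rintro ⟨i, hi, h2⟩
            exact ⟨i, by omega, by rw [if_neg (by omega), h2]⟩
        · simp only [hc, iff_true]
          exact ⟨m₂.nat 22 0, by omega, by simp⟩
    · simp [hc, h20]
      refine ⟨?_, ?_, hinj, ?_⟩
      · intro i hi hij; exact h9 i (by omega)
      · intro i hi; have := hlt i hi; omega
      · intro v hv
        rcases Nat.lt_succ_iff_lt_or_eq.1 (Nat.lt_succ_of_le hv) with h1 | rfl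
        · exact hmem v h1
        · simp only [hc, iff_false]
          rintro ⟨i, hi, h2⟩
          have := hlt i hi
          omega
  · rintro m₂ hF₂ ⟨h20, -⟩
    have hS₂ := (hS.frame hF rfl rfl rfl rfl rfl rfl).frame hF₂ rfl rfl rfl rfl rfl rfl
    simp [h20, hS₂.order]
  · simp only [Test.cost, NatExpr.cost]
    nlinarith
  · rintro m' - ⟨hF, h20, h9, hlt, hinj, hmem⟩
    have h6 : m'.nat 6 = m.nat 6 := hF.nat 6 rfl
    have h7 : m'.nat 7 = m.nat 7 := hF.nat 7 rfl
    refine ⟨rfl, by simp, Nat.zero_le _, hlt, hinj, ?_, ?_, ?_, by simp, by simp, ?_, by simp,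
      by simp, by simp, ?_⟩
    · intro v
      rw [hmem v v.isLt, hd, Finset.subset_empty, ← Finset.card_eq_zero]
      omega
    · intro v; simp [h6, hd]
    · intro v; simp [h7, hp]
    · intro v; rw [h9 v v.isLt]
    · rw [Finset.sum_congr rfl fun (v : Fin I.T.order) _ => h9 v v.isLt]; simp

theorem reach_strip : ∃ K : ℕ, ∀ {I : Instance} (R : I.T.Rooting) (m : Memory), I.Stored m →
    StripInv R ∅ 0 (m.nat 22 0) (m.nat 8) (m.nat 6) (m.nat 7) (m.nat 9) (m.nat 10) →
    Reach Code.strip m (K * (I.T.order + 1)) fun m' => m'.nat 21 0 = I.T.order - 1 ∧ ∃ D,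
      StripInv R D (I.T.order - 1) (m'.nat 22 0) (m'.nat 8) (m'.nat 6) (m'.nat 7) (m'.nat 9)
        (m'.nat 10) := by
  refine ⟨Code.stripBody.cost + 20, fun {I} R m hS hI => ?_⟩
  let Inv : ℕ → Memory → Prop := fun j m' => m'.nat 21 0 = j ∧ ∃ D,
    StripInv R D j (m'.nat 22 0) (m'.nat 8) (m'.nat 6) (m'.nat 7) (m'.nat 9) (m'.nat 10)
  refine (Reach.seq (Q' := Inv 0) (Reach.straight rfl ?_) fun m₁ hF h =>
    Reach.loop Inv (I.T.order - 1) Code.stripBody.cost h ?_ ?_).mono ?_ fun _ _ h => h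
  · refine ⟨by simp, ∅, ?_⟩
    simpa [Memory.writeNat_nat_array, -Memory.writeNat_nat] using hI
  · rintro j hj m₂ hF₂ ⟨h21, D, H⟩
    have hS₂ := (hS.frame hF rfl rfl rfl rfl rfl rfl).frame hF₂ rfl rfl rfl rfl rfl rfl
    refine ⟨by simp [h21, hS₂.order]; omega, Reach.straight rfl ?_⟩
    obtain ⟨V, hht, hV, hVD, hVr, hVc⟩ := H.exists_head (by omega)
    have hpar : m₂.nat 7 V = R.par V := by
      rw [H.par_eq, Finset.sdiff_eq_empty_iff_subset.2 hVc]; simp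
    have key := H.step hht hV hVD hVr hVc rfl
    simp only [Inv, Code.stripBody, Code.push, Program.exec, NatExpr.eval, Test.Holds,
      Memory.writeNat_nat_array]
    by_cases hc : m₂.nat 6 (R.par V) - 1 = 1
    · simp only [hc, if_true] at key
      simp [h21, hV, hpar, hc]
      exact ⟨_, key⟩
    · simp only [hc, if_false] at key
      simp [h21, hV, hpar, hc]
      exact ⟨_, key⟩
  · rintro m₂ hF₂ ⟨h21, -⟩
    have hS₂ := (hS.frame hF rfl rfl rfl rfl rfl rfl).frame hF₂ rfl rfl rfl rfl rfl rfl
    simp [h21, hS₂.order]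
    omega
  · simp only [Test.cost, NatExpr.cost, Program.cost]
    have : I.T.order - 1 ≤ I.T.order := Nat.sub_le _ _
    nlinarith

end UncertainTree

/-! ### Subtrees as intervals, and tables of ancestors. -/

namespace UncertainTree

open RealRAM

namespace LengthTree.Rooting

/-- A numbering `pre` of the vertices such that the subtree at every vertex `v` occupies the interval
of length `size v` at `pre v`. -/
structure Numbering {T : LengthTree} (R : T.Rooting) (pre size : Fin T.order → ℕ) : Prop where
  pre_root : pre R.root = 0
  size_root : size R.root = T.order
  size_pos : ∀ v, 1 ≤ size v
  lt : ∀ v, v ≠ R.root → pre (R.par v) < pre v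
  le : ∀ v, v ≠ R.root → pre v + size v ≤ pre (R.par v) + size (R.par v)
  disjoint : ∀ v v', v ≠ R.root → v' ≠ R.root → R.par v = R.par v' → v ≠ v' →
    pre v + size v ≤ pre v' ∨ pre v' + size v' ≤ pre v

namespace Numbering

variable {T : LengthTree} {R : T.Rooting} {pre size : Fin T.order → ℕ}

theorem interval_subset (h : R.Numbering pre size) {v u : Fin T.order} (hvu : R.Below v u) :
    pre v ≤ pre u ∧ pre u + size u ≤ pre v + size v := by
  obtain ⟨k, rfl⟩ := hvu
  induction k with
  | zero => simp
  | succ k ih =>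
    rw [Function.iterate_succ_apply']
    by_cases h0 : R.par^[k] u = R.root
    · rwa [h0, R.par_root, ← h0]
    · have := h.lt _ h0
      have := h.le _ h0
      omega

/-- Induction on the depth of `v`: the parent of `v` is above `u` since its interval is larger, and
the child through which one ascends from `u` to it has an interval containing `pre u`. Disjointness
of the intervals of siblings forces that child to be `v`. -/
theorem below_of_mem (h : R.Numbering pre size) {v u : Fin T.order} (h1 : pre v ≤ pre u)
    (h2 : pre u < pre v + size v) : R.Below v u := by
  induction hd : R.depth v generalizing v with
  | zero => rw [R.eq_root_of_depth hd]; exact R.below_root u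
  | succ d ih =>
    have hv : v ≠ R.root := by rintro rfl; rw [R.depth_root] at hd; omega
    have hd' := R.depth_par v hv
    have hlt := h.lt v hv
    have hle := h.le v hv
    have key : R.Below (R.par v) u := ih (by omega) (by omega) (by omega)
    obtain ⟨k, hk⟩ := key
    have hex : ∃ k, R.par^[k] u = R.par v := ⟨k, hk⟩
    classical
    -- Take the first arrival at `R.par v`: the vertex just before it is then not the root, which is
    -- its own parent, and so is a genuine child.
    have hmin : ∀ n < Nat.find hex, R.par^[n] u ≠ R.par v := fun n hn => Nat.find_min hex hn
    have hspec := Nat.find_spec hex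
    rcases hn : Nat.find hex with _ | n
    · rw [hn] at hspec
      simp only [Function.iterate_zero, id] at hspec
      rw [hspec] at h1
      omega
    · rw [hn] at hspec
      have hc := hmin n (by omega)
      rw [Function.iterate_succ_apply'] at hspec
      have hroot : R.par^[n] u ≠ R.root := by
        intro h0
        rw [h0, R.par_root] at hspec
        exact hc (h0.trans hspec)
      have hb : R.Below (R.par^[n] u) u := ⟨n, rfl⟩
      by_cases hcv : R.par^[n] u = v
      · exact ⟨n, hcv⟩
      · have := h.interval_subset hb
        have := h.size_pos u
        rcases h.disjoint _ v hroot hv hspec hcv with h3 | h3 <;> omega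

/-- This turns membership in a subtree into two comparisons of numbers, which the machine can test
in constant time. -/
theorem mem_iff (h : R.Numbering pre size) (v u : Fin T.order) :
    pre v ≤ pre u ∧ pre u < pre v + size v ↔ R.Below v u := by
  refine ⟨fun h' => h.below_of_mem h'.1 h'.2, fun h' => ?_⟩
  have := h.interval_subset h'
  have := h.size_pos u
  omega

theorem injective (h : R.Numbering pre size) : Function.Injective pre := by
  intro u v huv
  have h1 := h.size_pos u
  have h2 := h.size_pos v
  exact R.below_antisymm ((h.mem_iff u v).1 (by omega)) ((h.mem_iff v u).1 (by omega))

theorem pre_lt (h : R.Numbering pre size) (v : Fin T.order) : pre v < T.order := by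
  have := h.interval_subset (R.below_root v)
  have := h.size_pos v
  have := h.size_root
  have := h.pre_root
  omega

end Numbering

end LengthTree.Rooting

theorem StripInv.mem_iff_ne_root {T : LengthTree} {R : T.Rooting} {D : Finset (Fin T.order)}
    {t : ℕ} {q deg par size off : ℕ → ℕ}
    (H : StripInv R D (T.order - 1) t q deg par size off) (v : Fin T.order) :
    v ∈ D ↔ v ≠ R.root := by
  have h1 : D = {R.root}ᶜ := by
    apply Finset.eq_of_subset_of_card_le
    · intro v hv
      simp only [Finset.mem_compl, Finset.mem_singleton]
      rintro rfl
      exact H.ne_root hv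
    · rw [Finset.card_compl, H.card]; simp
  simp [h1]

theorem StripInv.par_eq_par {T : LengthTree} {R : T.Rooting} {D : Finset (Fin T.order)}
    {t : ℕ} {q deg par size off : ℕ → ℕ}
    (H : StripInv R D (T.order - 1) t q deg par size off) (v : Fin T.order) :
    par v = R.par v := by
  rw [H.par_eq, Finset.sdiff_eq_empty_iff_subset.2]
  · simp
  · intro c hc
    exact (H.mem_iff_ne_root c).2 (LengthTree.Rooting.mem_children.1 hc).1

/-- The position of a vertex is the sum of the relative offsets along its path to the root. -/
theorem StripInv.exists_numbering {T : LengthTree} {R : T.Rooting} {D : Finset (Fin T.order)}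
    {t : ℕ} {q deg par size off : ℕ → ℕ}
    (H : StripInv R D (T.order - 1) t q deg par size off) :
    ∃ pre : Fin T.order → ℕ, (∀ v, v ≠ R.root → pre v = off v + pre (R.par v)) ∧
      R.Numbering pre (fun v => size v) := by
  let pre : Fin T.order → ℕ := fun v => ∑ k ∈ Finset.range (R.depth v), off (R.par^[k] v)
  have hpre : ∀ v, v ≠ R.root → pre v = off v + pre (R.par v) := by
    intro v hv
    simp only [pre]
    rw [R.depth_par v hv, Finset.sum_range_succ']
    simp [add_comm]
  refine ⟨pre, hpre, by simp [pre, R.depth_root], ?_, H.size_pos, ?_, ?_, ?_⟩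
  · have h1 : Dᶜ = {R.root} := by ext v; simp [H.mem_iff_ne_root]
    have := H.total
    rwa [h1, Finset.sum_singleton] at this
  · intro v hv
    have := H.off_pos v ((H.mem_iff_ne_root v).2 hv)
    have := hpre v hv
    omega
  · intro v hv
    have := H.off_le v ((H.mem_iff_ne_root v).2 hv)
    have := hpre v hv
    omega
  · intro v v' hv hv' hp hne
    have := H.off_disj v ((H.mem_iff_ne_root v).2 hv) v' ((H.mem_iff_ne_root v').2 hv') hp hne
    have h1 := hpre v hv
    have h2 := hpre v' hv'
    rw [hp] at h1
    omega

namespace Code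

open NatExpr

/-- The queue is read backwards, starting from the counter left by `strip`, so that parents come
before their children. -/
def numberBody : Program :=
  .seq (.setNat 21 (.const 0) (.sub (var 21) (.const 1))) <|
  .seq (.setNat 23 (.const 0) (.get 8 (var 21))) <|
  .setNat 10 (var 23) (.add (.get 10 (var 23)) (.get 10 (.get 7 (var 23))))

/-- Compute the position of every vertex from its position relative to the parent. -/
def number : Program :=
  .seq (.setNat 10 (.const 0) (.const 0)) (.loop (.natLt (.const 0) (var 21)) numberBody)

def indexBody : Program :=
  .seq (.setNat 11 (.get 10 (var 20)) (var 20)) <|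
  .seq (.setNat 12 (var 20) (var 20)) <|
  .setNat 20 (.const 0) (.add (var 20) (.const 1))

/-- Invert the numbering, and write the table of ancestors at distance `0`. -/
def index : Program :=
  .seq (.setNat 20 (.const 0) (.const 0)) (.loop (.natLt (var 20) (.get 0 (.const 0))) indexBody)

/-- Two jumps of length `2 ^ l - 1` with one step to the parent in between make a jump of length `2
^ (l + 1) - 1`. Variable 26 holds `l` times the number of vertices, the start of the current row,
since index arithmetic has no multiplication. -/
def levelBody : Program :=
  .seq (.setNat 12 (.add (.add (var 26) (.get 0 (.const 0))) (var 20))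
    (.get 12 (.add (var 26) (.get 7 (.get 12 (.add (var 26) (var 20))))))) <|
  .setNat 20 (.const 0) (.add (var 20) (.const 1))

def levelNext : Program :=
  .seq (.setNat 13 (.add (var 25) (.const 1)) (.add (.get 13 (var 25)) (.get 13 (var 25)))) <|
  .seq (.setNat 25 (.const 0) (.add (var 25) (.const 1))) <|
  .setNat 26 (.const 0) (.add (var 26) (.get 0 (.const 0)))

/-- Compute the table of ancestors at distance `2 ^ (l + 1) - 1` from that for `2 ^ l - 1`. -/
def level : Program :=
  .seq (.setNat 20 (.const 0) (.const 0)) <|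
  .seq (.loop (.natLt (var 20) (.get 0 (.const 0))) levelBody) levelNext

def liftInit : Program :=
  .seq (.setNat 25 (.const 0) (.const 0)) <|
  .seq (.setNat 26 (.const 0) (.const 0)) <|
  .setNat 13 (.const 0) (.const 1)

def liftDone : Program :=
  .seq (.setNat 29 (.const 0) (var 25)) (.setNat 30 (.const 0) (var 26))

/-- Compute the tables of ancestors for all levels. -/
def lift : Program :=
  .seq liftInit <|
  .seq (.loop (.natLt (.get 13 (var 25)) (.get 0 (.const 0))) level) liftDone

end Code

/-- At each stage the queue entries still to be read hold relative offsets, and all other vertices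
hold final positions. By `StripInv.topo` the parent of the vertex being treated is of the second
kind. -/
theorem reach_number : ∃ K : ℕ, ∀ {I : Instance} (R : I.T.Rooting) (m : Memory) (D)
    (pre : Fin I.T.order → ℕ) (off : ℕ → ℕ), m.nat 10 = off →
    StripInv R D (I.T.order - 1) (m.nat 22 0) (m.nat 8) (m.nat 6) (m.nat 7) (m.nat 9) off →
    m.nat 21 0 = I.T.order - 1 →
    pre R.root = 0 → (∀ v, v ≠ R.root → pre v = off v + pre (R.par v)) →
    Reach Code.number m (K * (I.T.order + 1)) fun m' => ∀ v : Fin I.T.order,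
      m'.nat 10 v = pre v := by
  refine ⟨Code.numberBody.cost + 20, fun {I} R m D pre off hoff H h21 hr hp => ?_⟩
  let Inv : ℕ → Memory → Prop := fun j m' => m'.nat 21 0 = I.T.order - 1 - j ∧
    ∀ v : Fin I.T.order,
      ((∃ i < I.T.order - 1 - j, m.nat 8 i = v) → m'.nat 10 v = off v) ∧
      ((∀ i < I.T.order - 1 - j, m.nat 8 i ≠ v) → m'.nat 10 v = pre v)
  refine (Reach.seq (Q' := Inv 0) (Reach.straight rfl ?_) fun m₁ hF h =>
    Reach.loop Inv (I.T.order - 1) Code.numberBody.cost h ?_ ?_).mono ?_ ?_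
  · have hinit : ∀ v : Fin I.T.order, ((Program.setNat 10 (.const 0) (.const 0)).exec m).nat 10 v =
        if v = R.root then 0 else off v := by
      intro v
      simp [hoff, Fin.ext_iff, R.root_val]
    refine ⟨by simp [h21], fun v => ?_⟩
    have h0 := (H.mem_iff_ne_root v).symm.trans (H.mem_D v)
    rw [hinit]
    simp only [Nat.sub_zero]
    refine ⟨fun h1 => if_neg (h0.2 h1), fun h1 => ?_⟩
    have hv : v = R.root := by
      by_contra hv
      obtain ⟨j, hj, h2⟩ := h0.1 hv
      exact h1 j hj h2
    rw [if_pos hv, hv, hr]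
  · rintro j hj m₂ hF₂ ⟨h21, hinv⟩
    have h8 : m₂.nat 8 = m.nat 8 := (hF₂.nat 8 rfl).trans (hF.nat 8 rfl)
    have h7 : m₂.nat 7 = m.nat 7 := (hF₂.nat 7 rfl).trans (hF.nat 7 rfl)
    refine ⟨by simp [h21]; omega, Reach.straight rfl ?_⟩
    obtain ⟨i, hi⟩ : ∃ i, I.T.order - 1 - j = i + 1 := ⟨I.T.order - 1 - j - 1, by omega⟩
    have hi' : I.T.order - 1 - (j + 1) = i := by omega
    simp only [Inv, hi, hi'] at h21 hinv ⊢
    have hit : i < m.nat 22 0 := by have := H.le; omega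
    obtain ⟨V, hV⟩ : ∃ V : Fin I.T.order, m.nat 8 i = V := ⟨⟨_, H.lt_order i hit⟩, rfl⟩
    have hVr : V ≠ R.root := (H.mem_iff_ne_root V).1 ((H.mem_D V).2 ⟨i, by omega, hV⟩)
    have hVo := (hinv V).1 ⟨i, by omega, hV⟩
    have hPo := (hinv (R.par V)).2 (fun i' hi' => H.topo i (by omega) i' (by omega) V hV)
    have hpar := H.par_eq_par V
    simp [Code.numberBody, h21, h8, h7, hV, hpar, hVo, hPo, ← hp V hVr]
    intro v
    simp only [Fin.val_inj]
    by_cases hv : v = V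
    · subst hv
      simp only [if_true, implies_true, and_true]
      rintro i' hi' h3
      have := H.inj i' (by omega) i (by omega) (h3.trans hV.symm)
      omega
    · simp only [hv, if_false]
      refine ⟨fun i' hi' h3 => (hinv v).1 ⟨i', by omega, h3⟩, fun h3 => (hinv v).2 ?_⟩
      intro i' hi' h4
      rcases Nat.lt_succ_iff_lt_or_eq.1 hi' with h5 | rfl
      · exact h3 i' h5 h4
      · exact hv (Fin.ext (h4.symm.trans hV))
  · rintro m₂ hF₂ ⟨h21, -⟩
    simp [h21]
  · simp only [Test.cost, NatExpr.cost, Program.cost]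
    have : I.T.order - 1 ≤ I.T.order := Nat.sub_le _ _
    nlinarith
  · rintro m' - ⟨-, h⟩ v
    exact (h v).2 (by simp)

theorem reach_index : ∃ K : ℕ, ∀ {I : Instance} (m : Memory) (pre : Fin I.T.order → ℕ), I.Stored m →
    Function.Injective pre → (∀ v : Fin I.T.order, m.nat 10 v = pre v) →
    Reach Code.index m (K * (I.T.order + 1)) fun m' => ∀ v : Fin I.T.order,
      m'.nat 11 (pre v) = v ∧ m'.nat 12 v = v := by
  refine ⟨Code.indexBody.cost + 20, fun {I} m pre hS hinj hpre => ?_⟩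
  let Inv : ℕ → Memory → Prop := fun j m' => m'.nat 20 0 = j ∧
    ∀ v : Fin I.T.order, v < j → m'.nat 11 (pre v) = v ∧ m'.nat 12 v = v
  refine (Reach.seq (Q' := Inv 0) (Reach.straight rfl ?_) fun m₁ hF h =>
    Reach.loop Inv I.T.order Code.indexBody.cost h ?_ ?_).mono ?_ ?_
  · simp [Inv]
  · rintro j hj m₂ hF₂ ⟨h20, hinv⟩
    have hS₂ := (hS.frame hF rfl rfl rfl rfl rfl rfl).frame hF₂ rfl rfl rfl rfl rfl rfl
    have h10 : m₂.nat 10 = m.nat 10 := (hF₂.nat 10 rfl).trans (hF.nat 10 rfl)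
    have hj' := hpre ⟨j, hj⟩
    simp only at hj'
    refine ⟨by simp [h20, hS₂.order, hj], Reach.straight rfl ?_⟩
    simp [Inv, Code.indexBody, h20, h10, hj']
    intro v hv
    by_cases hvj : v = ⟨j, hj⟩
    · subst hvj; simp
    · have hvj' : (v : ℕ) ≠ j := fun h => hvj (Fin.ext h)
      have h1 := hinv v (by omega)
      simp [hinj.ne hvj, h1, hvj']
  · rintro m₂ hF₂ ⟨h20, -⟩
    have hS₂ := (hS.frame hF rfl rfl rfl rfl rfl rfl).frame hF₂ rfl rfl rfl rfl rfl rfl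
    simp [h20, hS₂.order]
  · simp only [Test.cost, NatExpr.cost, Program.cost]
    nlinarith
  · rintro m' - ⟨-, h⟩ v
    exact h v v.isLt

theorem reach_level : ∃ K : ℕ, ∀ {I : Instance} (R : I.T.Rooting) (m : Memory) (l : ℕ), I.Stored m →
    (∀ v : Fin I.T.order, m.nat 7 v = R.par v) → m.nat 25 0 = l → m.nat 26 0 = l * I.T.order →
    (∀ i ≤ l, m.nat 13 i = 2 ^ i) →
    (∀ i ≤ l, ∀ v : Fin I.T.order, m.nat 12 (i * I.T.order + v) = R.par^[2 ^ i - 1] v) →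
    Reach Code.level m (K * (I.T.order + 1)) fun m' =>
      m'.nat 25 0 = l + 1 ∧ m'.nat 26 0 = (l + 1) * I.T.order ∧
      (∀ i ≤ l + 1, m'.nat 13 i = 2 ^ i) ∧
      (∀ i ≤ l + 1, ∀ v : Fin I.T.order, m'.nat 12 (i * I.T.order + v) = R.par^[2 ^ i - 1] v) := by
  refine ⟨Code.levelBody.cost + Code.levelNext.cost + 20,
    fun {I} R m l hS h7 h25 h26 h13 h12 => ?_⟩
  let Inv : ℕ → Memory → Prop := fun j m' => m'.nat 20 0 = j ∧
    (∀ i ≤ l, ∀ v : Fin I.T.order, m'.nat 12 (i * I.T.order + v) = R.par^[2 ^ i - 1] v) ∧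
    (∀ v : Fin I.T.order, v < j →
      m'.nat 12 ((l + 1) * I.T.order + v) = R.par^[2 ^ (l + 1) - 1] v)
  have hbase : (l + 1) * I.T.order = l * I.T.order + I.T.order := by ring
  have hlev : ∀ i ≤ l, ∀ v : Fin I.T.order, i * I.T.order + v < (l + 1) * I.T.order := by
    intro i hi v
    have := Nat.mul_le_mul_right I.T.order hi
    have := v.isLt
    omega
  refine (Reach.seq (Q' := Inv 0) (Reach.straight rfl ?_) fun m₁ hF h =>
    Reach.seq (Q' := Inv I.T.order) (Reach.loop Inv I.T.order Code.levelBody.cost h ?_ ?_)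
    fun m₃ hF₃ h3 => Reach.straight rfl ?_).mono ?_ fun _ _ h => h
  · exact ⟨by simp, by simpa using h12, by simp⟩
  · rintro j hj m₂ hF₂ ⟨h20, hinv, hinv'⟩
    have hS₂ := (hS.frame hF rfl rfl rfl rfl rfl rfl).frame hF₂ rfl rfl rfl rfl rfl rfl
    have e7 : m₂.nat 7 = m.nat 7 := (hF₂.nat 7 rfl).trans (hF.nat 7 rfl)
    have e26 : m₂.nat 26 = m.nat 26 := (hF₂.nat 26 rfl).trans (hF.nat 26 rfl)
    refine ⟨by simp [h20, hS₂.order, hj], Reach.straight rfl ?_⟩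
    have hj' := hinv l le_rfl ⟨j, hj⟩
    simp only at hj'
    simp [Inv, Code.levelBody, h20, e26, h26, hj', e7, h7, hinv l le_rfl, hS₂.order, ← hbase]
    refine ⟨?_, ?_⟩
    · intro i hi v
      have := hlev i hi v
      rw [if_neg (by omega)]
      exact hinv i hi v
    · intro v hv
      split_ifs with h1
      · obtain rfl : v = ⟨j, hj⟩ := Fin.ext h1
        rw [Fin.val_inj, ← Function.iterate_succ_apply' R.par, ← Function.iterate_add_apply]
        congr 1
        have : 1 ≤ 2 ^ l := Nat.one_le_two_pow
        rw [pow_succ]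
        omega
      · exact hinv' v (by omega)
  · rintro m₂ hF₂ ⟨h20, -⟩
    have hS₂ := (hS.frame hF rfl rfl rfl rfl rfl rfl).frame hF₂ rfl rfl rfl rfl rfl rfl
    simp [h20, hS₂.order]
  · obtain ⟨-, hinv, hinv'⟩ := h3
    have hS₂ := (hS.frame hF rfl rfl rfl rfl rfl rfl).frame hF₃ rfl rfl rfl rfl rfl rfl
    have e25 : m₃.nat 25 = m.nat 25 := (hF₃.nat 25 rfl).trans (hF.nat 25 rfl)
    have e26 : m₃.nat 26 = m.nat 26 := (hF₃.nat 26 rfl).trans (hF.nat 26 rfl)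
    have e13 : m₃.nat 13 = m.nat 13 := (hF₃.nat 13 rfl).trans (hF.nat 13 rfl)
    simp [Code.levelNext, e25, e26, e13, h25, h26, hS₂.order, hbase]
    refine ⟨?_, ?_⟩
    · intro i hi
      split_ifs with h1
      · rw [h1, h13 l le_rfl]; ring
      · exact h13 i (by omega)
    · intro i hi v
      rcases Nat.le_succ_iff.1 hi with h1 | rfl
      · exact hinv i h1 v
      · exact hinv' v v.isLt
  · simp only [Test.cost, NatExpr.cost, Program.cost]
    nlinarith

theorem reach_lift : ∃ K : ℕ, ∀ {I : Instance} (R : I.T.Rooting) (m : Memory), I.Stored m →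
    (∀ v : Fin I.T.order, m.nat 7 v = R.par v) → (∀ v : Fin I.T.order, m.nat 12 v = v) →
    Reach Code.lift m (K * ((I.T.order + 1) * (Nat.clog 2 I.T.order + 1))) fun m' =>
      m'.nat 29 0 = Nat.clog 2 I.T.order ∧
      m'.nat 30 0 = Nat.clog 2 I.T.order * I.T.order ∧
      (∀ i ≤ Nat.clog 2 I.T.order, m'.nat 13 i = 2 ^ i) ∧
      (∀ i ≤ Nat.clog 2 I.T.order, ∀ v : Fin I.T.order,
        m'.nat 12 (i * I.T.order + v) = R.par^[2 ^ i - 1] v) := by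
  obtain ⟨K, hK⟩ := reach_level
  refine ⟨K + Code.liftInit.cost + Code.liftDone.cost + 20, fun {I} R m hS h7 h12 => ?_⟩
  set L := Nat.clog 2 I.T.order with hL
  let Inv : ℕ → Memory → Prop := fun l m => m.nat 25 0 = l ∧ m.nat 26 0 = l * I.T.order ∧
    (∀ i ≤ l, m.nat 13 i = 2 ^ i) ∧
    (∀ i ≤ l, ∀ v : Fin I.T.order, m.nat 12 (i * I.T.order + v) = R.par^[2 ^ i - 1] v)
  refine (Reach.seq (Q' := Inv 0) (Reach.straight rfl ?_) fun m₁ hF h =>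
    Reach.seq (Q' := Inv L) (Reach.loop Inv L (K * (I.T.order + 1)) h ?_ ?_)
    fun m₃ hF₃ h3 => Reach.straight rfl ?_).mono ?_ fun _ _ h => h
  · simpa [Inv, Code.liftInit] using h12
  · rintro l hl m₂ hF₂ ⟨h25, h26, h13, h12⟩
    have hS₂ := (hS.frame hF rfl rfl rfl rfl rfl rfl).frame hF₂ rfl rfl rfl rfl rfl rfl
    have e7 : m₂.nat 7 = m.nat 7 := (hF₂.nat 7 rfl).trans (hF.nat 7 rfl)
    refine ⟨?_, hK R m₂ l hS₂ (by rwa [e7]) h25 h26 h13 h12⟩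
    simp [h25, h13 l le_rfl, hS₂.order]
    -- The loop stops at the first power of two not below the number of vertices, which makes the
    -- number of levels `Nat.clog 2 I.T.order`.
    exact (Nat.lt_clog_iff_pow_lt (by norm_num)).1 hl
  · rintro m₂ hF₂ ⟨h25, h26, h13, h12⟩
    have hS₂ := (hS.frame hF rfl rfl rfl rfl rfl rfl).frame hF₂ rfl rfl rfl rfl rfl rfl
    simp [h25, h13 L le_rfl, hS₂.order]
    exact Nat.le_pow_clog (by norm_num) _
  · obtain ⟨h25, h26, h13, h12⟩ := h3
    simpa [Code.liftDone, h25, h26] using ⟨h13, h12⟩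
  · simp only [Test.cost, NatExpr.cost, Program.cost]
    nlinarith [Nat.zero_le (K * (I.T.order + 1)), Nat.zero_le L, Nat.zero_le (L * I.T.order)]

end UncertainTree

/-! ### Simultaneous binary search for all uncertain points. -/

namespace UncertainTree

open RealRAM

/-- Probabilities adding up to 1 leave no uncertain point without a location. Thus passes over the
uncertain points can be charged to `M`. -/
theorem Instance.n_le_M (I : Instance) : I.n ≤ I.M := by
  have h : Function.Surjective I.owner := by
    intro i
    by_contra hi
    have h1 := I.prob_sum i
    rw [Finset.sum_eq_zero] at h1
    · norm_num at h1
    · intro k hk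
      exact absurd ⟨k, (Finset.mem_filter.1 hk).2⟩ hi
  simpa using Fintype.card_le_of_surjective _ h

theorem Instance.order_le_M (I : Instance) : I.T.order ≤ I.M := by
  simpa using Fintype.card_le_of_surjective _ I.loc_surjective

namespace Code

open NatExpr

def clearBody : Program :=
  .seq (.setReal 3 (var 27) (.const 0)) (.setNat 27 (.const 0) (.add (var 27) (.const 1)))

def clear : Program :=
  .seq (.setNat 27 (.const 0) (.const 0)) (.loop (.natLt (var 27) (.get 0 (.const 2))) clearBody)

/-- Variable 27 receives the owner of the location first, so that `lo` and `hi` are evaluated for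
the uncertain point concerned. -/
def weighBody (lo hi : NatExpr) : Program :=
  .seq (.setNat 27 (.const 0) (.get 3 (var 28))) <|
  .seq (.ite (.conj (.neg (.natLt (.get 10 (.get 4 (var 28))) lo))
      (.natLt (.get 10 (.get 4 (var 28))) hi))
    (.setReal 3 (var 27) (.add (.get 3 (var 27)) (.get 1 (var 28)))) .skip) <|
  .setNat 28 (.const 0) (.add (var 28) (.const 1))

/-- Compute, for every uncertain point, the probability of its interval from `lo` to `hi`. -/
def weigh (lo hi : NatExpr) : Program :=
  .seq (.setNat 28 (.const 0) (.const 0))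
    (.loop (.natLt (var 28) (.get 0 (.const 3))) (weighBody lo hi))

def moveBody (upd : NatExpr) : Program :=
  .seq (.ite (.neg (.realLt (.const (1 / 2)) (.get 3 (var 27)))) (.setNat 5 (var 27) upd) .skip) <|
  .setNat 27 (.const 0) (.add (var 27) (.const 1))

/-- Replace the current value of every uncertain point whose interval has probability at most
`1 / 2`. -/
def move (upd : NatExpr) : Program :=
  .seq (.setNat 27 (.const 0) (.const 0))
    (.loop (.natLt (var 27) (.get 0 (.const 2))) (moveBody upd))

def round (lo hi upd : NatExpr) : Program :=
  .seq clear (.seq (weigh lo hi) (move upd))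

def searchInit : Program :=
  .seq (.setNat 25 (.const 0) (var 29)) (.setNat 26 (.const 0) (var 30))

def searchNext : Program :=
  .seq (.setNat 25 (.const 0) (.sub (var 25) (.const 1)))
    (.setNat 26 (.const 0) (.sub (var 26) (.get 0 (.const 0))))

/-- Simultaneous binary search for all uncertain points. -/
def search (lo hi upd : NatExpr) : Program :=
  .seq searchInit
    (.loop (.natLt (.const 0) (var 25)) (.seq searchNext (round lo hi upd)))

def decodeBody : Program :=
  .seq (.setNat 5 (var 27) (.get 11 (.get 5 (var 27))))
    (.setNat 27 (.const 0) (.add (var 27) (.const 1)))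

/-- Turn positions into vertices. -/
def decode : Program :=
  .seq (.setNat 27 (.const 0) (.const 0)) (.loop (.natLt (var 27) (.get 0 (.const 2))) decodeBody)

end Code

theorem reach_clear : ∃ K : ℕ, ∀ {I : Instance} (m : Memory), I.Stored m →
    Reach Code.clear m (K * (I.M + 1)) fun m' => ∀ i < I.n, m'.real 3 i = 0 := by
  refine ⟨Code.clearBody.cost + 20, fun {I} m hS => ?_⟩
  let Inv : ℕ → Memory → Prop := fun j m' => m'.nat 27 0 = j ∧ ∀ i < j, m'.real 3 i = 0
  refine (Reach.seq (Q' := Inv 0) (Reach.straight rfl ?_) fun m₁ hF h =>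
    Reach.loop Inv I.n Code.clearBody.cost h ?_ ?_).mono ?_ ?_
  · simp [Inv]
  · rintro j hj m₂ hF₂ ⟨h27, hinv⟩
    have hS₂ := (hS.frame hF rfl rfl rfl rfl rfl rfl).frame hF₂ rfl rfl rfl rfl rfl rfl
    refine ⟨by simp [h27, hS₂.n, hj], Reach.straight rfl ?_⟩
    simp [Inv, Code.clearBody, h27]
    exact fun i hi hij => hinv i (by omega)
  · rintro m₂ hF₂ ⟨h27, -⟩
    have hS₂ := (hS.frame hF rfl rfl rfl rfl rfl rfl).frame hF₂ rfl rfl rfl rfl rfl rfl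
    simp [h27, hS₂.n]
  · simp only [Test.cost, NatExpr.cost, Program.cost]
    nlinarith [I.n_le_M]
  · rintro m' - ⟨-, h⟩
    exact h

/-- The bounds are expressions evaluated anew for each location. Their values are only required in
memories that differ from `m` in the arrays 27 and 28 and have the uncertain point in variable 27.
-/
theorem reach_weigh (lo hi : NatExpr) : ∃ K : ℕ, ∀ {I : Instance} (m : Memory)
    (pre : Fin I.T.order → ℕ) (lo' hi' : Fin I.n → ℕ), I.Stored m →
    (∀ v : Fin I.T.order, m.nat 10 v = pre v) →
    (∀ (i : Fin I.n) (m' : Memory), (∀ a, a ≠ 27 → a ≠ 28 → m'.nat a = m.nat a) →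
      m'.nat 27 0 = i → lo.eval m' = lo' i ∧ hi.eval m' = hi' i) →
    (∀ i < I.n, m.real 3 i = 0) →
    Reach (Code.weigh lo hi) m (K * (I.M + 1)) fun m' => ∀ i : Fin I.n,
      m'.real 3 i = I.mass i (fun v => lo' i ≤ pre v ∧ pre v < hi' i) := by
  refine ⟨(Code.weighBody lo hi).cost + 20, fun {I} m pre lo' hi' hS hpre heval h3 => ?_⟩
  let Inv : ℕ → Memory → Prop := fun j m' => m'.nat 28 0 = j ∧ ∀ i : Fin I.n, m'.real 3 i =
    ∑ k : Fin I.M with k.val < j, if I.owner k = i then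
      (if lo' i ≤ pre (I.loc k) ∧ pre (I.loc k) < hi' i then I.prob k else 0) else 0
  refine (Reach.seq (Q' := Inv 0) (Reach.straight rfl ?_) fun m₁ hF h =>
    Reach.loop Inv I.M (Code.weighBody lo hi).cost h ?_ ?_).mono ?_ ?_
  · simp [Inv, h3]
  · rintro j hj m₂ hF₂ ⟨h28, hinv⟩
    have hS₂ := (hS.frame hF rfl rfl rfl rfl rfl rfl).frame hF₂ rfl rfl rfl rfl rfl rfl
    refine ⟨by simp [h28, hS₂.M, hj], Reach.straight rfl ?_⟩
    have e10 : m₂.nat 10 = m.nat 10 := (hF₂.nat 10 rfl).trans (hF.nat 10 rfl)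
    have ho := hS₂.owner ⟨j, hj⟩
    have hl := hS₂.loc ⟨j, hj⟩
    have hp := hS₂.prob ⟨j, hj⟩
    simp only at ho hl hp
    have hm : ∀ a, a ≠ 27 → a ≠ 28 →
        (m₂.writeNat 27 0 (I.owner ⟨j, hj⟩)).nat a = m.nat a := by
      intro a ha hb
      rw [Memory.writeNat_nat_array, if_neg ha, hF₂.nat a, hF.nat a]
      · simp [Program.writesNat, hb]
      · simp [Code.weighBody, Program.writesNat, ha, hb]
    obtain ⟨el, eh⟩ := heval (I.owner ⟨j, hj⟩) _ hm (by simp)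
    simp only [Inv, Fin.sum_lt_succ _ (⟨j, hj⟩ : Fin I.M)]
    simp only [Code.weighBody, Program.exec, NatExpr.eval, RealExpr.eval, Test.Holds, h28, ho]
    rw [el, eh]
    simp [hl, e10, hpre, h28, hp]
    by_cases hc : lo' (I.owner ⟨j, hj⟩) ≤ pre (I.loc ⟨j, hj⟩) ∧
        pre (I.loc ⟨j, hj⟩) < hi' (I.owner ⟨j, hj⟩)
    · simp [hc, h28]
      intro i
      by_cases hi : I.owner ⟨j, hj⟩ = i
      · subst hi
        simp [hc, hinv]
      · have hi' : (i : ℕ) ≠ I.owner ⟨j, hj⟩ := fun h => hi (Fin.ext h.symm)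
        simp [hi, hi', hinv]
    · simp only [hc, if_false]
      simp [h28]
      intro i
      by_cases hi : I.owner ⟨j, hj⟩ = i
      · subst hi
        simp [hc, hinv]
      · simp [hi, hinv]
  · rintro m₂ hF₂ ⟨h28, -⟩
    have hS₂ := (hS.frame hF rfl rfl rfl rfl rfl rfl).frame hF₂ rfl rfl rfl rfl rfl rfl
    simp [h28, hS₂.M]
  · simp only [Test.cost, NatExpr.cost, Program.cost]
    nlinarith
  · rintro m' - ⟨-, h⟩ i
    rw [h i, Instance.mass, Finset.sum_filter (fun k => I.owner k = i)]
    simp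

theorem reach_move (upd : NatExpr) : ∃ K : ℕ, ∀ {I : Instance} (m : Memory)
    (upd' : Fin I.n → ℕ), I.Stored m →
    (∀ (i : Fin I.n) (m' : Memory), (∀ a, a ≠ 5 → a ≠ 27 → m'.nat a = m.nat a) →
      m'.nat 27 0 = i → m'.nat 5 i = m.nat 5 i → upd.eval m' = upd' i) →
    Reach (Code.move upd) m (K * (I.M + 1)) fun m' => ∀ i : Fin I.n,
      m'.nat 5 i = if m.real 3 i ≤ 1 / 2 then upd' i else m.nat 5 i := by
  refine ⟨(Code.moveBody upd).cost + 20, fun {I} m upd' hS heval => ?_⟩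
  let Inv : ℕ → Memory → Prop := fun j m' => m'.nat 27 0 = j ∧ ∀ i : Fin I.n,
    m'.nat 5 i = if i < j ∧ m.real 3 i ≤ 1 / 2 then upd' i else m.nat 5 i
  refine (Reach.seq (Q' := Inv 0) (Reach.straight rfl ?_) fun m₁ hF h =>
    Reach.loop Inv I.n (Code.moveBody upd).cost h ?_ ?_).mono ?_ ?_
  · simp [Inv]
  · rintro j hj m₂ hF₂ ⟨h27, hinv⟩
    have hS₂ := (hS.frame hF rfl rfl rfl rfl rfl rfl).frame hF₂ rfl rfl rfl rfl rfl rfl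
    refine ⟨by simp [h27, hS₂.n, hj], Reach.straight rfl ?_⟩
    have e3 : m₂.real 3 = m.real 3 := (hF₂.real 3 rfl).trans (hF.real 3 rfl)
    have hm : ∀ a, a ≠ 5 → a ≠ 27 → m₂.nat a = m.nat a := by
      intro a ha hb
      rw [hF₂.nat a, hF.nat a]
      · simp [Program.writesNat, hb]
      · simp [Code.moveBody, Program.writesNat, ha, hb]
    have eu := heval ⟨j, hj⟩ m₂ hm h27 (by rw [hinv]; simp)
    simp only [Inv, Code.moveBody, Program.exec, NatExpr.eval, RealExpr.eval, Test.Holds, h27, e3,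
      eu, not_lt]
    have hlt : ∀ i : Fin I.n, i ≠ ⟨j, hj⟩ → (i.val < j + 1 ↔ i.val < j) := by
      intro i hi
      have : i.val ≠ j := fun h => hi (Fin.ext h)
      omega
    by_cases hc : m.real 3 j ≤ 1 / 2
    · have hc' : m.real 3 j ≤ ((1 / 2 : ℚ) : ℝ) := by simpa using hc
      rw [if_pos hc']
      refine ⟨by simp [h27], fun i => ?_⟩
      by_cases hi : i = ⟨j, hj⟩
      · subst hi
        simp [-one_div, hc]
      · have hi' : i.val ≠ j := fun h => hi (Fin.ext h)
        simp [-one_div, hi', hinv, hlt i hi]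
    · have hc' : ¬ m.real 3 j ≤ ((1 / 2 : ℚ) : ℝ) := by simpa using hc
      rw [if_neg hc']
      refine ⟨by simp [h27], fun i => ?_⟩
      by_cases hi : i = ⟨j, hj⟩
      · subst hi
        have := hinv ⟨j, hj⟩
        simp only [hc, and_false, if_false] at this
        simp only [hc, and_false, if_false]
        simpa using this
      · simp [-one_div, hinv, hlt i hi]
  · rintro m₂ hF₂ ⟨h27, -⟩
    have hS₂ := (hS.frame hF rfl rfl rfl rfl rfl rfl).frame hF₂ rfl rfl rfl rfl rfl rfl
    simp [h27, hS₂.n]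
  · simp only [Test.cost, NatExpr.cost, Program.cost]
    nlinarith [I.n_le_M]
  · rintro m' - ⟨-, h⟩ i
    rw [h i]
    simp

theorem reach_round (lo hi upd : NatExpr) : ∃ K : ℕ, ∀ {I : Instance} (m : Memory)
    (pre : Fin I.T.order → ℕ) (lo' hi' upd' : Fin I.n → ℕ), I.Stored m →
    (∀ v : Fin I.T.order, m.nat 10 v = pre v) →
    (∀ (i : Fin I.n) (m' : Memory), (∀ a, a ≠ 5 → a ≠ 27 → a ≠ 28 → m'.nat a = m.nat a) →
      m'.nat 27 0 = i → m'.nat 5 i = m.nat 5 i →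
      lo.eval m' = lo' i ∧ hi.eval m' = hi' i ∧ upd.eval m' = upd' i) →
    Reach (Code.round lo hi upd) m (K * (I.M + 1)) fun m' => ∀ i : Fin I.n,
      m'.nat 5 i = if I.mass i (fun v => lo' i ≤ pre v ∧ pre v < hi' i) ≤ 1 / 2 then upd' i
        else m.nat 5 i := by
  obtain ⟨K₁, h₁⟩ := reach_clear
  obtain ⟨K₂, h₂⟩ := reach_weigh lo hi
  obtain ⟨K₃, h₃⟩ := reach_move upd
  refine ⟨K₁ + K₂ + K₃, fun {I} m pre lo' hi' upd' hS hpre heval => ?_⟩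
  have f₁ : ∀ a, a ≠ 27 → Code.clear.writesNat a = false := by
    intro a ha
    simp [Code.clear, Code.clearBody, Program.writesNat, ha]
  have f₂ : ∀ a, a ≠ 27 → a ≠ 28 → (Code.weigh lo hi).writesNat a = false := by
    intro a ha hb
    simp [Code.weigh, Code.weighBody, Program.writesNat, ha, hb]
  have final : ∀ m₁ m₂, Code.clear.Frame m m₁ → (Code.weigh lo hi).Frame m₁ m₂ →
      (∀ i : Fin I.n, m₂.real 3 i = I.mass i (fun v => lo' i ≤ pre v ∧ pre v < hi' i)) →
      Reach (Code.move upd) m₂ (K₃ * (I.M + 1)) fun m' => ∀ i : Fin I.n,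
        m'.nat 5 i = if I.mass i (fun v => lo' i ≤ pre v ∧ pre v < hi' i) ≤ 1 / 2 then upd' i
          else m.nat 5 i := by
    intro m₁ m₂ hF₁ hF₂ hQ
    have e5 : m₂.nat 5 = m.nat 5 := (hF₂.nat 5 rfl).trans (hF₁.nat 5 rfl)
    refine (h₃ m₂ upd' ((hS.frame hF₁ rfl rfl rfl rfl rfl rfl).frame hF₂ rfl rfl rfl rfl rfl rfl)
      fun i m' hm h27 h5 => ?_).mono le_rfl fun m' _ h i => ?_
    · rw [e5] at h5
      refine (heval i m' (fun a h5 h7 h8 => ?_) h27 h5).2.2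
      rw [hm a h5 h7, hF₂.nat a (f₂ a h7 h8), hF₁.nat a (f₁ a h7)]
    · rw [h i, hQ i, e5]
  refine (Reach.seq (h₁ m hS) fun m₁ hF₁ hQ₁ => Reach.seq (h₂ m₁ pre lo' hi'
    (hS.frame hF₁ rfl rfl rfl rfl rfl rfl) (by rwa [hF₁.nat 10 rfl]) ?_ hQ₁)
    fun m₂ hF₂ hQ₂ => final m₁ m₂ hF₁ hF₂ hQ₂).mono (by ring_nf; omega) fun _ _ h => h
  intro i m' hm h27
  have h := heval i m' (fun a h5 h7 h8 => by rw [hm a h7 h8, hF₁.nat a (f₁ a h7)]) h27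
    (by rw [hm 5 (by norm_num) (by norm_num), hF₁.nat 5 rfl])
  exact ⟨h.1, h.2.1⟩

/-- Here `pt i j` is the stored representation of the search state `j` of the uncertain point `i`,
and `js i` the threshold sought. After `s` rounds the state satisfies `j ≤ js i < j + 2 ^ (L - s)`;
a round at level `l` tests `j + 2 ^ l` and keeps the half containing `js i`. Separating `pt` from
`j` lets one search serve both positions and ancestors, where the number of steps climbed is not
stored. -/
theorem reach_search (lo hi upd : NatExpr) : ∃ K : ℕ, ∀ {I : Instance} (m : Memory) (L : ℕ)
    (pre : Fin I.T.order → ℕ) (lo' hi' pt : Fin I.n → ℕ → ℕ) (js : Fin I.n → ℕ), I.Stored m →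
    (∀ v : Fin I.T.order, m.nat 10 v = pre v) →
    m.nat 29 0 = L → m.nat 30 0 = L * I.T.order → (∀ i : Fin I.n, m.nat 5 i = pt i 0) →
    (∀ i, js i < 2 ^ L) →
    (∀ l < L, ∀ (i : Fin I.n) (j : ℕ) (m' : Memory),
      (∀ a, a ≠ 5 → a ≠ 25 → a ≠ 26 → a ≠ 27 → a ≠ 28 → m'.nat a = m.nat a) →
      m'.nat 25 0 = l → m'.nat 26 0 = l * I.T.order → m'.nat 27 0 = i → m'.nat 5 i = pt i j →
      lo.eval m' = lo' i (j + 2 ^ l) ∧ hi.eval m' = hi' i (j + 2 ^ l) ∧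
        upd.eval m' = pt i (j + 2 ^ l)) →
    (∀ i j, 1 ≤ j → (I.mass i (fun v => lo' i j ≤ pre v ∧ pre v < hi' i j) ≤ 1 / 2 ↔ j ≤ js i)) →
    Reach (Code.search lo hi upd) m (K * ((I.M + 1) * (L + 1))) fun m' => ∀ i : Fin I.n,
      m'.nat 5 i = pt i (js i) := by
  obtain ⟨K, hK⟩ := reach_round lo hi upd
  refine ⟨K + Code.searchInit.cost + Code.searchNext.cost + 20,
    fun {I} m L pre lo' hi' pt js hS hpre h29 h30 h5 hjs heval htest => ?_⟩
  let Inv : ℕ → Memory → Prop := fun s m' => m'.nat 25 0 = L - s ∧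
    m'.nat 26 0 = (L - s) * I.T.order ∧
    ∀ i : Fin I.n, ∃ j, m'.nat 5 i = pt i j ∧ j ≤ js i ∧ js i < j + 2 ^ (L - s)
  have f₀ : ∀ a, a ≠ 25 → a ≠ 26 → Code.searchInit.writesNat a = false := by
    intro a ha hb
    simp [Code.searchInit, Program.writesNat, ha, hb]
  have f₁ : ∀ a, a ≠ 5 → a ≠ 25 → a ≠ 26 → a ≠ 27 → a ≠ 28 →
      (Program.seq Code.searchNext (Code.round lo hi upd)).writesNat a = false := by
    intro a h1 h2 h3 h4 h5
    simp [Code.searchNext, Code.round, Code.clear, Code.clearBody, Code.weigh, Code.weighBody,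
      Code.move, Code.moveBody, Program.writesNat, h1, h2, h3, h4, h5]
  have f₂ : ∀ a, a ≠ 25 → a ≠ 26 → Code.searchNext.writesNat a = false := by
    intro a ha hb
    simp [Code.searchNext, Program.writesNat, ha, hb]
  refine (Reach.seq (Q' := Inv 0) (Reach.straight rfl ?_) fun m₁ hF h =>
    Reach.loop Inv L (Code.searchNext.cost + K * (I.M + 1)) h ?_ ?_).mono ?_ ?_
  · refine ⟨by simp [Code.searchInit, h29], by simp [Code.searchInit, h30], fun i => ⟨0, ?_⟩⟩
    simp [Code.searchInit, h5, hjs]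
  · rintro s hs m₂ hF₂ ⟨h25, h26, hinv⟩
    have hS₂ := (hS.frame hF rfl rfl rfl rfl rfl rfl).frame hF₂ rfl rfl rfl rfl rfl rfl
    refine ⟨by simp [h25]; omega, ?_⟩
    obtain ⟨l, hl⟩ : ∃ l, L - s = l + 1 := ⟨L - s - 1, by omega⟩
    have hl' : L - (s + 1) = l := by omega
    choose j hj5 hj1 hj2 using hinv
    simp only [hl] at h25 h26 hj2
    refine Reach.seq (Q' := fun m' => m'.nat 25 0 = l ∧ m'.nat 26 0 = l * I.T.order)
      (Reach.straight rfl ?_) fun m₃ hF₃ hQ₃ => ?_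
    · simp [Code.searchNext, h25, h26, hS₂.order, Nat.succ_mul]
    · have e5 : m₃.nat 5 = m₂.nat 5 := hF₃.nat 5 rfl
      have e10 : m₃.nat 10 = m.nat 10 :=
        ((hF₃.nat 10 rfl).trans (hF₂.nat 10 rfl)).trans (hF.nat 10 rfl)
      refine (hK m₃ pre (fun i => lo' i (j i + 2 ^ l)) (fun i => hi' i (j i + 2 ^ l))
        (fun i => pt i (j i + 2 ^ l)) (hS₂.frame hF₃ rfl rfl rfl rfl rfl rfl) (by rwa [e10])
        fun i m' hm h27 h5' => ?_).frame.mono le_rfl ?_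
      · refine heval l (by omega) i (j i) m' (fun a h1 h2 h3 h4 h5 => ?_) ?_ ?_ h27 ?_
        · rw [hm a h1 h4 h5, hF₃.nat a (f₂ a h2 h3), hF₂.nat a (f₁ a h1 h2 h3 h4 h5),
            hF.nat a (f₀ a h2 h3)]
        · rw [hm 25 (by norm_num) (by norm_num) (by norm_num), hQ₃.1]
        · rw [hm 26 (by norm_num) (by norm_num) (by norm_num), hQ₃.2]
        · rw [h5', e5, hj5]
      · rintro m' - ⟨hF₄, h⟩
        refine ⟨by rw [hF₄.nat 25 rfl, hQ₃.1, hl'], by rw [hF₄.nat 26 rfl, hQ₃.2, hl'],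
          fun i => ?_⟩
        have hpos : 1 ≤ 2 ^ l := Nat.one_le_two_pow
        have ht := htest i (j i + 2 ^ l) (by omega)
        have hj2i := hj2 i
        rw [pow_succ] at hj2i
        rw [h i, hl']
        simp only [ht]
        by_cases hc : j i + 2 ^ l ≤ js i
        · exact ⟨_, by rw [if_pos hc], hc, by omega⟩
        · exact ⟨j i, by rw [if_neg hc, e5, hj5], hj1 i, by omega⟩
  · rintro m₂ hF₂ ⟨h25, -⟩
    simp [h25]
  · simp only [Test.cost, NatExpr.cost, Program.cost]
    nlinarith [Nat.zero_le (K * (I.M + 1)), Nat.zero_le L, Nat.zero_le (L * I.M)]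
  · rintro m' - ⟨-, -, h⟩ i
    obtain ⟨j, h1, h2, h3⟩ := h i
    simp only [Nat.sub_self, pow_zero] at h3
    rw [h1, show j = js i by omega]

theorem reach_decode : ∃ K : ℕ, ∀ {I : Instance} (m : Memory), I.Stored m →
    Reach Code.decode m (K * (I.M + 1)) fun m' => ∀ i : Fin I.n,
      m'.nat 5 i = m.nat 11 (m.nat 5 i) := by
  refine ⟨Code.decodeBody.cost + 20, fun {I} m hS => ?_⟩
  let Inv : ℕ → Memory → Prop := fun j m' => m'.nat 27 0 = j ∧
    ∀ i, m'.nat 5 i = if i < j then m.nat 11 (m.nat 5 i) else m.nat 5 i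
  refine (Reach.seq (Q' := Inv 0) (Reach.straight rfl ?_) fun m₁ hF h =>
    Reach.loop Inv I.n Code.decodeBody.cost h ?_ ?_).mono ?_ ?_
  · simp [Inv]
  · rintro j hj m₂ hF₂ ⟨h27, hinv⟩
    have hS₂ := (hS.frame hF rfl rfl rfl rfl rfl rfl).frame hF₂ rfl rfl rfl rfl rfl rfl
    have e11 : m₂.nat 11 = m.nat 11 := (hF₂.nat 11 rfl).trans (hF.nat 11 rfl)
    refine ⟨by simp [h27, hS₂.n, hj], Reach.straight rfl ?_⟩
    simp [Inv, Code.decodeBody, h27, e11]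
    intro i
    by_cases hi : i = j
    · simp [hi, hinv]
    · have : i ≤ j ↔ i < j := by omega
      simp [hi, hinv, this]
  · rintro m₂ hF₂ ⟨h27, -⟩
    have hS₂ := (hS.frame hF rfl rfl rfl rfl rfl rfl).frame hF₂ rfl rfl rfl rfl rfl rfl
    simp [h27, hS₂.n]
  · simp only [Test.cost, NatExpr.cost, Program.cost]
    nlinarith [I.n_le_M]
  · rintro m' - ⟨-, h⟩ i
    rw [h i, if_pos i.isLt]

end UncertainTree

/-! ### The median by two thresholds, and the total running time. -/

namespace UncertainTree

open RealRAM

section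

variable {I : Instance} {R : I.T.Rooting} {pre size : Fin I.T.order → ℕ}

/-- The masses of initial segments increase to 1, so there is a first position at which they exceed
`1 / 2`. -/
theorem exists_half_position (h : R.Numbering pre size) (i : Fin I.n) :
    ∃ u, ∀ x, I.mass i (fun v => 0 ≤ pre v ∧ pre v < x) ≤ 1 / 2 ↔ x ≤ pre u := by
  classical
  have hex : ∃ q, 1 / 2 < I.mass i (fun v => 0 ≤ pre v ∧ pre v < q + 1) := by
    refine ⟨I.T.order, ?_⟩
    have h1 := Instance.mass_add_mass_not i (fun v => 0 ≤ pre v ∧ pre v < I.T.order + 1)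
    have h2 : I.mass i (fun v => ¬ (0 ≤ pre v ∧ pre v < I.T.order + 1)) = 0 := by
      refine Finset.sum_eq_zero fun k _ => if_neg ?_
      have := h.pre_lt (I.loc k)
      omega
    linarith
  have hspec := Nat.find_spec hex
  have hmin : ∀ q < Nat.find hex, ¬ 1 / 2 < I.mass i (fun v => 0 ≤ pre v ∧ pre v < q + 1) :=
    fun q hq => Nat.find_min hex hq
  set q := Nat.find hex
  have hle : ∀ x ≤ q, I.mass i (fun v => 0 ≤ pre v ∧ pre v < x) ≤ 1 / 2 := by
    intro x hx
    rcases x with _ | x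
    · rw [Instance.mass, Finset.sum_eq_zero]
      · norm_num
      · simp
    · exact not_lt.1 (hmin x hx)
  -- An unoccupied position could not increase the mass of the initial segment, so a vertex sits at
  -- `q`.
  obtain ⟨u, hu⟩ : ∃ u, pre u = q := by
    by_contra hne
    push Not at hne
    refine absurd (hle q le_rfl) (not_le.2 (hspec.trans_le (Instance.mass_mono fun v hv => ?_)))
    have := hne v
    omega
  refine ⟨u, fun x => ⟨fun hx => ?_, fun hx => hle x (by omega)⟩⟩
  by_contra hlt
  refine absurd hx (not_le.2 (hspec.trans_le (Instance.mass_mono fun v hv => ?_)))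
  omega

/-- Subtree masses increase along the ancestors of `u` and reach 1 at the root; `k` is the first
height at which they exceed `1 / 2`. The test for `x` inspects the ancestor at distance `x - 1`, so
that it succeeds exactly for `x ≤ k`. This shift is why the tables store jumps of length `2 ^ l -
1`: the entry is the vertex to be tested, and its parent the vertex to move to. -/
theorem exists_half_height (h : R.Numbering pre size) (i : Fin I.n) (u : Fin I.T.order) :
    ∃ k < I.T.order, ∀ x, 1 ≤ x → (I.mass i (fun v => pre (R.par^[x - 1] u) ≤ pre v ∧
      pre v < pre (R.par^[x - 1] u) + size (R.par^[x - 1] u)) ≤ 1 / 2 ↔ x ≤ k) := by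
  classical
  have hm : ∀ c, I.mass i (fun v => pre c ≤ pre v ∧ pre v < pre c + size c) =
      I.mass i (R.Below c) := fun c => Instance.mass_congr fun v => h.mem_iff c v
  have hroot : 1 / 2 < I.mass i (R.Below (R.par^[R.depth u] u)) := by
    rw [R.iterate_par_eq_root le_rfl]
    have h1 := Instance.mass_add_mass_not i (R.Below R.root)
    have h2 : I.mass i (fun v => ¬ R.Below R.root v) = 0 :=
      Finset.sum_eq_zero fun k _ => if_neg (not_not.2 (R.below_root _))
    linarith
  have hex : ∃ k, 1 / 2 < I.mass i (R.Below (R.par^[k] u)) := ⟨_, hroot⟩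
  have hspec := Nat.find_spec hex
  have hmin : ∀ k < Nat.find hex, ¬ 1 / 2 < I.mass i (R.Below (R.par^[k] u)) :=
    fun k hk => Nat.find_min hex hk
  refine ⟨Nat.find hex, (Nat.find_min' hex hroot).trans_lt (R.depth_lt_order u), fun x hx => ?_⟩
  rw [hm]
  constructor
  · intro hx'
    by_contra hlt
    refine absurd hx' (not_le.2 (hspec.trans_le (Instance.mass_mono fun v hv => ?_)))
    refine R.below_trans ⟨x - 1 - Nat.find hex, ?_⟩ hv
    rw [← Function.iterate_add_apply]
    congr 1
    omega
  · intro hx'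
    exact not_lt.1 (hmin _ (by omega))

/-- The lowest vertex above `u` whose subtree has probability more than `1 / 2` is a median, where
`u` halves the probability in the order of the numbering. -/
theorem isMedian_of_half (h : R.Numbering pre size) {i : Fin I.n} {u : Fin I.T.order}
    (hu : ∀ x, I.mass i (fun v => 0 ≤ pre v ∧ pre v < x) ≤ 1 / 2 ↔ x ≤ pre u) {k : ℕ}
    (hk : ∀ x, 1 ≤ x → (I.mass i (fun v => pre (R.par^[x - 1] u) ≤ pre v ∧
      pre v < pre (R.par^[x - 1] u) + size (R.par^[x - 1] u)) ≤ 1 / 2 ↔ x ≤ k)) :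
    I.IsMedian i (.vertex (R.par^[k] u)) := by
  classical
  have hm : ∀ c, I.mass i (fun v => pre c ≤ pre v ∧ pre v < pre c + size c) =
      I.mass i (R.Below c) := fun c => Instance.mass_congr fun v => h.mem_iff c v
  refine Instance.isMedian_of_heavy R fun c _ => ⟨fun hc => ?_, fun hc => ?_⟩
  · have h1 := (hk (k + 1) (by omega)).not.2 (by omega)
    rw [hm, Nat.add_sub_cancel, not_le] at h1
    exact h1.le.trans (Instance.mass_mono fun v hv => R.below_trans hc hv)
  · by_contra hlt
    have hlt := not_le.1 hlt
    -- An interval missing `pre u` lies entirely before it, where the mass is at most `1 / 2`, or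
    -- entirely after it, where less than `1 / 2` remains. So a subtree of larger mass contains `u`.
    have hcu : R.Below c u := by
      rw [← h.mem_iff]
      by_contra hnot
      rw [← hm] at hlt
      by_cases h1 : pre c ≤ pre u
      · have h2 := (hu (pre u)).2 le_rfl
        refine absurd h2 (not_le.2 (hlt.trans_le (Instance.mass_mono fun v hv => ?_)))
        omega
      · have h2 := (hu (pre u + 1)).not.2 (by omega)
        have h3 := Instance.mass_add_mass_not i (fun v => 0 ≤ pre v ∧ pre v < pre u + 1)
        have h4 : I.mass i (fun v => pre c ≤ pre v ∧ pre v < pre c + size c) ≤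
            I.mass i (fun v => ¬ (0 ≤ pre v ∧ pre v < pre u + 1)) :=
          Instance.mass_mono fun v hv => by omega
        linarith [not_le.1 h2]
    obtain ⟨l, rfl⟩ := hcu
    refine hc ⟨l - k, ?_⟩
    -- Ancestors at distance less than `k` have mass at most `1 / 2`, so `c` is at distance at least
    -- `k` and hence above the chosen vertex, contrary to `hc`.
    have hkl : k ≤ l := by
      by_contra hkl
      have h1 := (hk (l + 1) (by omega)).2 (by omega)
      rw [hm, Nat.add_sub_cancel] at h1
      linarith
    rw [← Function.iterate_add_apply]
    congr 1
    omega

end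

namespace Code

open NatExpr

/-- Find the position that halves the probability. -/
def searchPosition : Program :=
  search (.const 0) (.add (.get 5 (var 27)) (.get 13 (var 25)))
    (.add (.get 5 (var 27)) (.get 13 (var 25)))

/-- The vertex above the current one, at distance `2 ^ l - 1`. -/
def jump : NatExpr := .get 12 (.add (var 26) (.get 5 (var 27)))

/-- Find the lowest vertex above the current one whose subtree has probability more than `1 / 2`. -/
def searchHeight : Program :=
  search (.get 10 jump) (.add (.get 10 jump) (.get 9 jump)) (.get 7 jump)

/-- Root the tree, and number its vertices. -/
def prepare : Program :=
  .seq degree (.seq leaves (.seq strip (.seq number (.seq index lift))))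

/-- Compute medians of all uncertain points. -/
def medians : Program :=
  .seq prepare (.seq searchPosition (.seq decode searchHeight))

end Code

/-- The memory holds the rooted tree, the numbering of its vertices, and the tables of ancestors. -/
structure Prepared (I : Instance) (R : I.T.Rooting) (pre size : Fin I.T.order → ℕ) (L : ℕ)
    (m : Memory) : Prop where
  stored : I.Stored m
  numbering : R.Numbering pre size
  par : ∀ v : Fin I.T.order, m.nat 7 v = R.par v
  size_eq : ∀ v : Fin I.T.order, m.nat 9 v = size v
  pre_eq : ∀ v : Fin I.T.order, m.nat 10 v = pre v
  inv : ∀ v : Fin I.T.order, m.nat 11 (pre v) = v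
  levels : m.nat 29 0 = L
  base : m.nat 30 0 = L * I.T.order
  pow : ∀ l ≤ L, m.nat 13 l = 2 ^ l
  table : ∀ l ≤ L, ∀ v : Fin I.T.order, m.nat 12 (l * I.T.order + v) = R.par^[2 ^ l - 1] v

theorem reach_prepare : ∃ K : ℕ, ∀ I : Instance,
    Reach Code.prepare I.input (K * ((I.M + 1) * (Nat.clog 2 I.T.order + 1))) fun m' =>
      m'.nat 5 = (fun _ => 0) ∧ ∃ (R : I.T.Rooting) (pre size : Fin I.T.order → ℕ),
        Prepared I R pre size (Nat.clog 2 I.T.order) m' := by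
  obtain ⟨K₁, h₁⟩ := reach_degree
  obtain ⟨K₂, h₂⟩ := reach_leaves
  obtain ⟨K₃, h₃⟩ := reach_strip
  obtain ⟨K₄, h₄⟩ := reach_number
  obtain ⟨K₅, h₅⟩ := reach_index
  obtain ⟨K₆, h₆⟩ := reach_lift
  refine ⟨K₁ + K₂ + K₃ + K₄ + K₅ + K₆, fun I => ?_⟩
  obtain ⟨R⟩ := I.T.nonempty_rooting
  set L := Nat.clog 2 I.T.order with hL
  have hN := I.order_le_M
  have hsize := I.T.size_lt_order
  have b : ∀ K n : ℕ, n ≤ I.M → K * (n + 1) ≤ K * ((I.M + 1) * (L + 1)) := by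
    intro K n hn
    refine Nat.mul_le_mul_left _ ?_
    nlinarith [Nat.zero_le (I.M * L)]
  have b₆ : K₆ * ((I.T.order + 1) * (L + 1)) ≤ K₆ * ((I.M + 1) * (L + 1)) := by gcongr
  refine (Reach.seq (h₁ R I.input I.stored_input rfl rfl) fun m₁ hF₁ h₁ => ?_).mono
    (t := K₁ * (I.T.size + 1) + (K₂ * (I.T.order + 1) + (K₃ * (I.T.order + 1) +
      (K₄ * (I.T.order + 1) + (K₅ * (I.T.order + 1) + K₆ * ((I.T.order + 1) * (L + 1)))))))
    ?_ fun _ _ h => h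
  · have hS₁ := I.stored_input.frame hF₁ rfl rfl rfl rfl rfl rfl
    refine Reach.seq (h₂ R m₁ hS₁ h₁.1 h₁.2) fun m₂ hF₂ h₂ => ?_
    have hS₂ := hS₁.frame hF₂ rfl rfl rfl rfl rfl rfl
    refine Reach.seq (h₃ R m₂ hS₂ h₂) fun m₃ hF₃ h₃ => ?_
    have hS₃ := hS₂.frame hF₃ rfl rfl rfl rfl rfl rfl
    obtain ⟨h21, D, H⟩ := h₃
    obtain ⟨pre, hpre, hnum⟩ := H.exists_numbering
    refine Reach.seq (h₄ R m₃ D pre _ rfl H h21 hnum.pre_root hpre) fun m₄ hF₄ h₄ => ?_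
    have hS₄ := hS₃.frame hF₄ rfl rfl rfl rfl rfl rfl
    refine Reach.seq (h₅ m₄ pre hS₄ hnum.injective h₄) fun m₅ hF₅ h₅ => ?_
    have hS₅ := hS₄.frame hF₅ rfl rfl rfl rfl rfl rfl
    have h7 : ∀ v : Fin I.T.order, m₅.nat 7 v = R.par v := by
      intro v
      rw [hF₅.nat 7 rfl, hF₄.nat 7 rfl, H.par_eq_par]
    refine (h₆ R m₅ hS₅ h7 fun v => (h₅ v).2).frame.mono le_rfl ?_
    rintro m₆ - ⟨hF₆, h29, h30, h13, h12⟩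
    refine ⟨?_, R, pre, _, hS₅.frame hF₆ rfl rfl rfl rfl rfl rfl, hnum, ?_, ?_, ?_, ?_, h29, h30,
      h13, h12⟩
    · rw [hF₆.nat 5 rfl, hF₅.nat 5 rfl, hF₄.nat 5 rfl, hF₃.nat 5 rfl, hF₂.nat 5 rfl,
        hF₁.nat 5 rfl]
      rfl
    · intro v; rw [hF₆.nat 7 rfl, h7]
    · intro v; rw [hF₆.nat 9 rfl, hF₅.nat 9 rfl, hF₄.nat 9 rfl]
    · intro v; rw [hF₆.nat 10 rfl, hF₅.nat 10 rfl, h₄]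
    · intro v; rw [hF₆.nat 11 rfl, (h₅ v).1]
  · have := b K₁ _ (hsize.le.trans hN)
    have := b K₂ _ hN
    have := b K₃ _ hN
    have := b K₄ _ hN
    have := b K₅ _ hN
    simp only [Nat.add_mul _ _ ((I.M + 1) * (L + 1))]
    omega

theorem reach_searches : ∃ K : ℕ, ∀ {I : Instance} (R : I.T.Rooting)
    (pre size : Fin I.T.order → ℕ) (m : Memory),
    Prepared I R pre size (Nat.clog 2 I.T.order) m → m.nat 5 = (fun _ => 0) →
    Reach (.seq Code.searchPosition (.seq Code.decode Code.searchHeight)) m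
      (K * ((I.M + 1) * (Nat.clog 2 I.T.order + 1))) fun m' => I.HoldsMedians m' := by
  obtain ⟨K₁, h₁⟩ := reach_search (.const 0) (.add (.get 5 (.var 27)) (.get 13 (.var 25)))
    (.add (.get 5 (.var 27)) (.get 13 (.var 25)))
  obtain ⟨K₂, h₂⟩ := reach_decode
  obtain ⟨K₃, h₃⟩ := reach_search (.get 10 Code.jump) (.add (.get 10 Code.jump) (.get 9 Code.jump))
    (.get 7 Code.jump)
  refine ⟨K₁ + K₂ + K₃, fun {I} R pre size m hP h5 => ?_⟩
  set L := Nat.clog 2 I.T.order with hL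
  have hNL : I.T.order ≤ 2 ^ L := Nat.le_pow_clog (by norm_num) _
  have hnum := hP.numbering
  choose u hu using exists_half_position hnum
  choose k hkN hk using fun i => exists_half_height hnum i (u i)
  have b : K₂ * (I.M + 1) ≤ K₂ * ((I.M + 1) * (L + 1)) := by
    refine Nat.mul_le_mul_left _ ?_
    nlinarith [Nat.zero_le (I.M * L)]
  -- In the first search the state is the position itself, and the interval tested is an initial
  -- segment.
  refine (Reach.seq (h₁ m L pre (fun _ _ => 0) (fun _ x => x) (fun _ j => j) (fun i => pre (u i))
    hP.stored hP.pre_eq hP.levels hP.base (by simp [h5]) ?_ ?_ ?_) fun m₁ hF₁ h₁ => ?_).mono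
    (t := K₁ * ((I.M + 1) * (L + 1)) + (K₂ * (I.M + 1) + K₃ * ((I.M + 1) * (L + 1)))) ?_
    fun _ _ h => h
  · exact fun i => (hnum.pre_lt (u i)).trans_le hNL
  · intro l hl i j m' hm h25 _ h27 h5'
    have e13 := hm 13 (by norm_num) (by norm_num) (by norm_num) (by norm_num) (by norm_num)
    simp [h25, h27, h5', e13, hP.pow l hl.le]
  · exact fun i x _ => hu i x
  · have hS₁ := hP.stored.frame hF₁ rfl rfl rfl rfl rfl rfl
    refine Reach.seq (h₂ m₁ hS₁) fun m₂ hF₂ h₂ => ?_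
    have hS₂ := hS₁.frame hF₂ rfl rfl rfl rfl rfl rfl
    -- In the second search the state is a height above `u i`, represented by the ancestor at that
    -- height.
    refine (h₃ m₂ L pre (fun i x => pre (R.par^[x - 1] (u i)))
      (fun i x => pre (R.par^[x - 1] (u i)) + size (R.par^[x - 1] (u i)))
      (fun i j => R.par^[j] (u i)) k hS₂ ?_ ?_ ?_ ?_ ?_ ?_ ?_).mono le_rfl ?_
    · rw [hF₂.nat 10 rfl, hF₁.nat 10 rfl]; exact hP.pre_eq
    · rw [hF₂.nat 29 rfl, hF₁.nat 29 rfl]; exact hP.levels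
    · rw [hF₂.nat 30 rfl, hF₁.nat 30 rfl]; exact hP.base
    · intro i
      rw [h₂ i, h₁ i, hF₁.nat 11 rfl, hP.inv]
      rfl
    · exact fun i => (hkN i).trans_le hNL
    · intro l hl i j m' hm h25 h26 h27 h5'
      have e : ∀ a, a ≠ 5 → a ≠ 25 → a ≠ 26 → a ≠ 27 → a ≠ 28 →
          Code.decode.writesNat a = false → Code.searchPosition.writesNat a = false →
          m'.nat a = m.nat a := by
        intro a h1 h2 h3 h4 h5 h6 h7
        rw [hm a h1 h2 h3 h4 h5, hF₂.nat a h6, hF₁.nat a h7]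
      have e7 := e 7 (by norm_num) (by norm_num) (by norm_num) (by norm_num) (by norm_num) rfl rfl
      have e9 := e 9 (by norm_num) (by norm_num) (by norm_num) (by norm_num) (by norm_num) rfl rfl
      have e10 := e 10 (by norm_num) (by norm_num) (by norm_num) (by norm_num) (by norm_num) rfl rfl
      have e12 := e 12 (by norm_num) (by norm_num) (by norm_num) (by norm_num) (by norm_num) rfl rfl
      have hpos : 1 ≤ 2 ^ l := Nat.one_le_two_pow
      have hjump : Code.jump.eval m' = R.par^[j + 2 ^ l - 1] (u i) := by
        simp only [Code.jump, NatExpr.eval, h26, h27, h5', e12]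
        rw [hP.table l hl.le, ← Function.iterate_add_apply]
        congr 2
        omega
      simp only [NatExpr.eval, hjump, e7, e9, e10, hP.par, hP.size_eq, hP.pre_eq, true_and]
      rw [← Function.iterate_succ_apply' R.par]
      congr 2
      omega
    · exact hk
    · intro m₃ _ h i
      exact ⟨_, h i, isMedian_of_half hnum (hu i) (hk i)⟩
  · simp only [Nat.add_mul _ _ ((I.M + 1) * (L + 1))]
    omega

/-- Since `log 2 > 1 / 2`, the rounded binary logarithm is at most `2 log M + 1`. The linear terms
are absorbed by `M ≤ 1 + 2 M log M`. -/
theorem clog_mul_le {n M : ℕ} (hn : n ≤ M) (hM : 1 ≤ M) :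
    (((M + 1) * (Nat.clog 2 n + 1) : ℕ) : ℝ) ≤ 12 * ((M : ℝ) * Real.log M + 1) := by
  have hlog : 0 ≤ Real.log M := Real.log_natCast_nonneg M
  have hM' : (1 : ℝ) ≤ M := by exact_mod_cast hM
  have hc : (Nat.clog 2 n : ℝ) ≤ 2 * Real.log M + 1 := by
    by_cases h1 : 1 < n
    · have h2 := Nat.pow_pred_clog_lt_self (b := 2) (by norm_num) h1
      have h3 : ((2 : ℝ) ^ (Nat.clog 2 n).pred) ≤ M := by exact_mod_cast h2.le.trans hn
      have h4 := Real.log_le_log (by positivity) h3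
      rw [Real.log_pow] at h4
      have h5 : (Nat.clog 2 n : ℝ) ≤ (Nat.clog 2 n).pred + 1 := by
        have : Nat.clog 2 n ≤ (Nat.clog 2 n).pred + 1 := by
          rw [Nat.pred_eq_sub_one]; omega
        exact_mod_cast this
      have h6 : (0 : ℝ) ≤ (Nat.clog 2 n).pred := Nat.cast_nonneg _
      nlinarith [Real.log_two_gt_d9]
    · rw [Nat.clog_of_right_le_one (by omega)]
      push_cast
      linarith
  have hself : (M : ℝ) ≤ 1 + 2 * (M * Real.log M) := by
    rcases Nat.eq_or_lt_of_le hM with h1 | h1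
    · simp [← h1]
    · have h2 : (2 : ℝ) ≤ M := by exact_mod_cast h1
      have h3 := Real.log_le_log (by norm_num) h2
      nlinarith [Real.log_two_gt_d9]
  push_cast
  -- This product is `4 M log M + 4 M`, and `4 M ≤ 4 + 8 M log M`, whence the factor 12.
  have h1 : ((M : ℝ) + 1) * (Nat.clog 2 n + 1) ≤ (2 * M) * (2 * Real.log M + 2) := by
    apply mul_le_mul <;> first | positivity | linarith
  nlinarith

theorem one_le_M (I : Instance) : 1 ≤ I.M := I.T.order_pos.trans_le I.order_le_M

end UncertainTree

/-- All medians of the uncertain points can be computed together in `O(M log M)` time: one program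
does it on every vertex-constrained instance, with one constant (the `+ 1` matters only for
`M = 1`, where `log M = 0`). -/
theorem mainTheorem7 :
    ∃ (p : RealRAM.Program) (C : ℝ), ∀ I : UncertainTree.Instance,
      ∃ (t : ℕ) (m : RealRAM.Memory),
        RealRAM.Runs p I.input t m ∧ I.HoldsMedians m ∧
          (t : ℝ) ≤ C * ((I.M : ℝ) * Real.log (I.M : ℝ) + 1) := by
  obtain ⟨K₁, h₁⟩ := UncertainTree.reach_prepare
  obtain ⟨K₂, h₂⟩ := UncertainTree.reach_searches
  refine ⟨UncertainTree.Code.medians, (K₁ + K₂) * 12, fun I => ?_⟩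
  obtain ⟨t, m, hrun, ht, hm⟩ := RealRAM.Reach.seq (h₁ I) fun m _ hm => by
    obtain ⟨h5, R, pre, size, hP⟩ := hm
    exact h₂ R pre size m hP h5
  refine ⟨t, m, hrun, hm, ?_⟩
  have hb := UncertainTree.clog_mul_le I.order_le_M (UncertainTree.one_le_M I)
  have ht' : (t : ℝ) ≤ ((K₁ + K₂ : ℕ) : ℝ) *
      (((I.M + 1) * (Nat.clog 2 I.T.order + 1) : ℕ) : ℝ) := by
    rw [← Nat.cast_mul, Nat.add_mul]
    exact_mod_cast ht
  rw [mul_assoc]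
  refine ht'.trans ?_
  push_cast at hb ⊢
  exact mul_le_mul_of_nonneg_left hb (by positivity)
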